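/- Let $n\ge 2$, let $B_r\subset\mathbb R^n$ be the open ball of radius $r$ centred at $0$, and let $p\in(0,\infty)$, $q\in(0,\infty]$ satisfy $\frac np+\frac1q<\frac2n$ (with $\frac1\infty=0$). For all $\Lambda,\delta,K\in\mathbb R$ there is a constant $C>0$, depending only on $n,p,q,\Lambda,\delta,K$, such that the following holds. Let $p_0\in(0,\infty]$ with $p_0\ge\frac{p}{n-1}$. Let $a=(a_{ij})$ be a measurable field of symmetric real $n\times n$ matrices on $B_1$, and let $\lambda,d>0$ be functions on $B_1$ such that, for almost every $x\in B_1$, $$\frac{d(x)}{\lambda(x)}|\xi|^2\le \sum_{i,j}a_{ij}(x)\xi_i\xi_j\le\lambda(x)^{n-1}|\xi|^2\qquad\text{for all }\xi\in\mathbb R^n,$$ with $\lambda\in L^p(B_1)$, $d^{-1}\in L^q(B_1)$, $\|\lambda\|_{L^p(B_1)}\le\Lambda$ and $\|d^{-1}\|_{L^q(B_1)}\le\delta$. Let $c,f\in L^{p_0}(B_1)$ with $\|c\|_{L^{p_0}(B_1)}\le K$. Let $u\in W^{1,p}(B_1)$ be a weak subsolution of $-D_j(a_{ij}D_iu)+cu=f$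 in $B_1$, that is, for every $\varphi\in W^{1,p}_0(B_1)$ with $\varphi\ge0$ a.e., the functions $\sum_{i,j}a_{ij}D_iu\,D_j\varphi+cu\varphi$ and $f\varphi$ are integrable on $B_1$ and $$\int_{B_1}\Big(\sum_{i,j}a_{ij}D_iu\,D_j\varphi+cu\varphi\Big)dx\le\int_{B_1}f\varphi\,dx.$$ Then $$\sup_{B_{1/2}}u\le C\left(\|u^+\|_{L^1(B_1)}+\|f\|_{L^{p_0}(B_1)}\right),$$ where $u^+=\max(u,0)$ and $\sup$ is the essential supremum. -/

import Mathlib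

open MeasureTheory
open scoped ENNReal ContDiff

noncomputable section

/-- Smooth functions with compact support contained in `Ω`. -/
structure IsTestFunction {n : ℕ} (Ω : Set (EuclideanSpace ℝ (Fin n)))
    (ψ : EuclideanSpace ℝ (Fin n) → ℝ) : Prop where
  smooth : ContDiff ℝ ∞ ψ
  compact : HasCompactSupport ψ
  support : tsupport ψ ⊆ Ω

/-- `u ∈ W^{1,p}(Ω)` (for `1 ≤ p`), with weak gradient `Du = (D₁u, …, Dₙu)`: both `u` and `Du` are
in `L^p(Ω)`, and `∫_Ω u Dᵢψ = -∫_Ω (Dᵢu) ψ` for every test function `ψ` and every `i`. -/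
structure HasSobolevGradient {n : ℕ} (Ω : Set (EuclideanSpace ℝ (Fin n))) (p : ℝ≥0∞)
    (u : EuclideanSpace ℝ (Fin n) → ℝ)
    (Du : EuclideanSpace ℝ (Fin n) → EuclideanSpace ℝ (Fin n)) : Prop where
  memLp : MemLp u p (volume.restrict Ω)
  memLp_grad : MemLp Du p (volume.restrict Ω)
  weak : ∀ ψ, IsTestFunction Ω ψ → ∀ i : Fin n,
    ∫ x in Ω, u x * fderiv ℝ ψ x (EuclideanSpace.single i 1) = -∫ x in Ω, Du x i * ψ x

/-- `φ ∈ W₀^{1,p}(Ω)` with weak gradient `Dφ`: the closure of the test functions in the norm of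
`W^{1,p}(Ω)`. -/
structure HasSobolevGradientZero {n : ℕ} (Ω : Set (EuclideanSpace ℝ (Fin n))) (p : ℝ≥0∞)
    (φ : EuclideanSpace ℝ (Fin n) → ℝ)
    (Dφ : EuclideanSpace ℝ (Fin n) → EuclideanSpace ℝ (Fin n)) : Prop
    extends HasSobolevGradient Ω p φ Dφ where
  approx : ∀ ε : ℝ≥0∞, 0 < ε → ∃ ψ, IsTestFunction Ω ψ ∧
    eLpNorm (fun x => φ x - ψ x) p (volume.restrict Ω) +
      eLpNorm (fun x => Dφ x - gradient ψ x) p (volume.restrict Ω) ≤ ε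

/-- `u ∈ W^{1,p}(Ω)` is a weak subsolution of `-Dⱼ(aᵢⱼ Dᵢu) + c u = f` in `Ω`: for all nonnegative
`φ ∈ W₀^{1,p}(Ω)`, both integrals below exist and
`∫_Ω aᵢⱼ Dᵢu Dⱼφ + c u φ ≤ ∫_Ω f φ`. The weak gradient is unique almost everywhere, so it
does not matter which version of `Du` is chosen. -/
def IsWeakSubsolution {n : ℕ} (Ω : Set (EuclideanSpace ℝ (Fin n))) (p : ℝ≥0∞)
    (a : EuclideanSpace ℝ (Fin n) → Matrix (Fin n) (Fin n) ℝ)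
    (c f u : EuclideanSpace ℝ (Fin n) → ℝ) : Prop :=
  ∃ Du, HasSobolevGradient Ω p u Du ∧
    ∀ φ Dφ, HasSobolevGradientZero Ω p φ Dφ → (∀ᵐ x ∂(volume.restrict Ω), 0 ≤ φ x) →
      IntegrableOn (fun x => (∑ i, ∑ j, a x i j * Du x i * Dφ x j) + c x * u x * φ x) Ω ∧
      IntegrableOn (fun x => f x * φ x) Ω ∧
      ∫ x in Ω, ((∑ i, ∑ j, a x i j * Du x i * Dφ x j) + c x * u x * φ x) ≤ ∫ x in Ω, f x * φ x

/-- The matrix field `a` is measurable and, at almost every `x ∈ Ω`, symmetric with `d, lam > 0` and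
`(d / lam) I ≤ a ≤ lam ^ (n - 1) I` in the sense of quadratic forms. -/
structure DegenerateElliptic {n : ℕ} (Ω : Set (EuclideanSpace ℝ (Fin n)))
    (a : EuclideanSpace ℝ (Fin n) → Matrix (Fin n) (Fin n) ℝ)
    (lam d : EuclideanSpace ℝ (Fin n) → ℝ) : Prop where
  measurable : ∀ i j, AEStronglyMeasurable (fun x => a x i j) (volume.restrict Ω)
  symm : ∀ᵐ x ∂(volume.restrict Ω), (a x).IsSymm
  lam_pos : ∀ᵐ x ∂(volume.restrict Ω), 0 < lam x
  d_pos : ∀ᵐ x ∂(volume.restrict Ω), 0 < d x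
  lower : ∀ᵐ x ∂(volume.restrict Ω), ∀ ξ : EuclideanSpace ℝ (Fin n),
    d x / lam x * ‖ξ‖ ^ 2 ≤ ∑ i, ∑ j, a x i j * ξ i * ξ j
  upper : ∀ᵐ x ∂(volume.restrict Ω), ∀ ξ : EuclideanSpace ℝ (Fin n),
    ∑ i, ∑ j, a x i j * ξ i * ξ j ≤ lam x ^ (n - 1) * ‖ξ‖ ^ 2

end

/-! The subsolution is tested with `η² H(u)`, where `η` is a cutoff and `H` is smooth, convex and
squeezed between `(t - k)⁺` and `(t - h)⁺` for levels `h < k`. With `w = (u - h)⁺`, this Caccioppoli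
argument bounds the weighted energy `∫ (d/λ) |D(η H(u))|²` by an integral `∫ w² Z`, where `Z`
combines `λ^(n-1)`, `|c|` and `|f|`.

Both sides lose integrability. Since `Z` is controlled in `L^(p/(n-1))`, Hölder's inequality asks
for `w` in `L^σ` with `2/σ + (n-1)/p = 1`. Removing the weight `d/λ` leaves the gradient in `L^r`
with `1/r = 1/2 + 1/(2p) + 1/(2q)`, and the Sobolev inequality then gives `L^τ` with `1/τ = 1/r -
1/n`. The condition `n/p + 1/q < 2/n` says exactly that `σ < τ`. This gain is
`exists_step_constant`.

De Giorgi's iteration (`ae_le_of_truncNorm_le`) turns the gain into boundedness. Chebyshev's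
inequality makes the recursion for the `L^σ` norms superlinear along shrinking balls and rising
levels, so `u ≤ 2M` on the smaller ball once `‖u⁺‖_σ ≤ ε M` and `M ≥ ‖f‖`. All levels lie between
`M` and `2M`, which lets the terms with `c` and `f` be treated as quadratic in `w`.

The `L^σ` norm is finally replaced by the `L^1` norm (`exists_ae_le_of_step`): interpolate between
`L^1` and the supremum on a slightly larger ball, absorb a small multiple of that supremum, and sum
over a chain of balls. The chain can start because the Sobolev inequality puts `u` in `L^σ` locally,
so some finite bound is known; its size drops out in the limit. -/

/-! ### Mollification in `L^p` -/

section Mollification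

open Filter Topology

variable {E F : Type*} [NormedAddCommGroup E] [NormedSpace ℝ E] [FiniteDimensional ℝ E]
  [MeasurableSpace E] [BorelSpace E] [NormedAddCommGroup F] [NormedSpace ℝ F]
  {μ : Measure E} [μ.IsAddHaarMeasure]

/-- Young's inequality for the convolution with a normed bump function. -/
theorem eLpNorm_normed_convolution_le (ρ : ContDiffBump (0 : E)) {p : ℝ≥0∞} (hp1 : 1 ≤ p)
    (hp : p ≠ ⊤) {g : E → F} (hg : AEStronglyMeasurable g μ) :
    eLpNorm (convolution (ρ.normed μ) g (ContinuousLinearMap.lsmul ℝ ℝ) μ) p μ ≤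
      eLpNorm g p μ := by
  -- The exchange of integrals below needs joint measurability of `g (x - t)`, hence a strongly
  -- measurable representative.
  wlog hgm : StronglyMeasurable g generalizing g
  · rw [convolution_congr _ (Filter.EventuallyEq.refl _ (ρ.normed μ)) hg.ae_eq_mk,
      eLpNorm_congr_ae hg.ae_eq_mk]
    exact this hg.stronglyMeasurable_mk.aestronglyMeasurable hg.stronglyMeasurable_mk
  have hp0 : p ≠ 0 := (zero_lt_one.trans_le hp1).ne'
  have hρm : Measurable (fun t => ENNReal.ofReal (ρ.normed μ t)) :=
    ρ.continuous_normed.measurable.ennreal_ofReal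
  -- The bump is a probability density, so monotonicity of `L^p` norms under `ν` is Jensen's
  -- inequality for the average; Tonelli and translation invariance finish.
  set ν := μ.withDensity (fun t => ENNReal.ofReal (ρ.normed μ t)) with hν
  have hprob : IsProbabilityMeasure ν := by
    refine ⟨?_⟩
    rw [hν, withDensity_apply _ MeasurableSet.univ, Measure.restrict_univ,
      ← ofReal_integral_eq_lintegral_ofReal ρ.integrable_normed
        (Eventually.of_forall ρ.nonneg_normed), ρ.integral_normed, ENNReal.ofReal_one]
  have hsub : ∀ x : E, StronglyMeasurable (fun t => g (x - t)) := fun x =>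
    hgm.comp_measurable (measurable_const.sub measurable_id)
  have hpt : ∀ x, ‖convolution (ρ.normed μ) g (ContinuousLinearMap.lsmul ℝ ℝ) μ x‖ₑ ^ p.toReal ≤
      ∫⁻ t, ‖g (x - t)‖ₑ ^ p.toReal ∂ν := by
    intro x
    have h1 : ‖convolution (ρ.normed μ) g (ContinuousLinearMap.lsmul ℝ ℝ) μ x‖ₑ ≤
        ∫⁻ t, ‖g (x - t)‖ₑ ∂ν := by
      rw [convolution_def]
      refine (enorm_integral_le_lintegral_enorm _).trans_eq ?_
      rw [hν, lintegral_withDensity_eq_lintegral_mul _ hρm (hsub x).enorm]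
      refine lintegral_congr fun t => ?_
      simp only [ContinuousLinearMap.lsmul_apply, Pi.mul_apply, enorm_smul]
      rw [Real.enorm_of_nonneg (ρ.nonneg_normed t)]
    have h2 := eLpNorm_le_eLpNorm_of_exponent_le (μ := ν) hp1 (hsub x).aestronglyMeasurable
    rw [eLpNorm_one_eq_lintegral_enorm, eLpNorm_eq_lintegral_rpow_enorm_toReal hp0 hp] at h2
    refine (ENNReal.rpow_le_rpow (h1.trans h2) ENNReal.toReal_nonneg).trans_eq ?_
    rw [← ENNReal.rpow_mul, one_div, inv_mul_cancel₀ (ENNReal.toReal_pos hp0 hp).ne',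
      ENNReal.rpow_one]
  rw [eLpNorm_eq_lintegral_rpow_enorm_toReal hp0 hp, eLpNorm_eq_lintegral_rpow_enorm_toReal hp0 hp]
  gcongr ?_ ^ _
  calc ∫⁻ x, ‖convolution (ρ.normed μ) g (ContinuousLinearMap.lsmul ℝ ℝ) μ x‖ₑ ^ p.toReal ∂μ
      ≤ ∫⁻ x, ∫⁻ t, ‖g (x - t)‖ₑ ^ p.toReal ∂ν ∂μ := lintegral_mono hpt
    _ = ∫⁻ t, ∫⁻ x, ‖g (x - t)‖ₑ ^ p.toReal ∂μ ∂ν := by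
        refine lintegral_lintegral_swap (Measurable.aemeasurable ?_)
        exact ((hgm.comp_measurable (measurable_fst.sub measurable_snd)).enorm).pow_const _
    _ = ∫⁻ _, ∫⁻ x, ‖g x‖ₑ ^ p.toReal ∂μ ∂ν := by
        refine lintegral_congr fun t => ?_
        exact lintegral_sub_right_eq_self (fun x => ‖g x‖ₑ ^ p.toReal) t
    _ = ∫⁻ x, ‖g x‖ₑ ^ p.toReal ∂μ := by simp

/-- Mollifications of an `L^p` function converge to it in `L^p`. -/
theorem tendsto_eLpNorm_normed_convolution_sub [CompleteSpace F] {ι : Type*} {l : Filter ι} {p : ℝ≥0∞}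
    (hp1 : 1 ≤ p) (hp : p ≠ ⊤) {g : E → F} (hg : MemLp g p μ)
    {ρ : ι → ContDiffBump (0 : E)} (hρ : Tendsto (fun i => (ρ i).rOut) l (𝓝 0)) :
    Tendsto (fun i => eLpNorm (fun x => convolution ((ρ i).normed μ) g
      (ContinuousLinearMap.lsmul ℝ ℝ) μ x - g x) p μ) l (𝓝 0) := by
  have hp0 : p ≠ 0 := (zero_lt_one.trans_le hp1).ne'
  rw [ENNReal.tendsto_nhds_zero]
  intro ε hε
  obtain ⟨δ, hδ, hδε⟩ : ∃ δ : ℝ≥0∞, 0 < δ ∧ δ + δ + δ ≤ ε := by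
    refine ⟨ε / 3, ENNReal.div_pos hε.ne' (by simp), ?_⟩
    rw [ENNReal.add_thirds]
  obtain ⟨h, hhs, hhd, hhc, hhp⟩ := hg.exists_hasCompactSupport_eLpNorm_sub_le hp hδ.ne'
  -- For mollifiers of radius at most one, the mollification error of `h` vanishes off this fixed
  -- compact set, so uniform smallness there is smallness in `L^p`.
  set K : Set E := Metric.cthickening 1 (tsupport h) with hK
  have hKc : IsCompact K := hhs.isCompact.cthickening
  have hKμ : μ K ≠ ⊤ := hKc.measure_lt_top.ne
  obtain ⟨c, hc, hcδ⟩ : ∃ c : ℝ, 0 < c ∧ ENNReal.ofReal c * μ K ^ (1 / p.toReal) ≤ δ := by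
    have hfin : μ K ^ (1 / p.toReal) ≠ ⊤ :=
      ENNReal.rpow_ne_top_of_nonneg (by positivity) hKμ
    have : Tendsto (fun c : ℝ => ENNReal.ofReal c * μ K ^ (1 / p.toReal)) (𝓝[>] 0) (𝓝 0) := by
      have h1 : Tendsto (fun c : ℝ => ENNReal.ofReal c) (𝓝[>] 0) (𝓝 0) := by
        have := (ENNReal.continuous_ofReal.tendsto 0).mono_left
          (nhdsWithin_le_nhds (a := (0 : ℝ)) (s := Set.Ioi 0))
        simpa using this
      simpa using ENNReal.Tendsto.mul_const h1 (Or.inr hfin)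
    obtain ⟨c, h1, h2⟩ := ((ENNReal.tendsto_nhds_zero.1 this δ hδ).and
      self_mem_nhdsWithin).exists
    exact ⟨c, h2, h1⟩
  obtain ⟨η, hη, hηc⟩ := Metric.uniformContinuous_iff.1 (hhs.uniformContinuous_of_continuous hhc) c hc
  have hev : ∀ᶠ i in l, (ρ i).rOut < min η 1 :=
    hρ.eventually (gt_mem_nhds (lt_min hη one_pos))
  filter_upwards [hev] with i hi
  set C : (E → F) → E → F := fun g => convolution ((ρ i).normed μ) g
      (ContinuousLinearMap.lsmul ℝ ℝ) μ with hC
  have hcex : ∀ {g : E → F}, LocallyIntegrable g μ → ConvolutionExists ((ρ i).normed μ) g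
      (ContinuousLinearMap.lsmul ℝ ℝ) μ := fun hg =>
    (ρ i).hasCompactSupport_normed.convolutionExists_left _ (ρ i).continuous_normed hg
  have hghp : MemLp (g - h) p μ := hg.sub hhp
  have hsplit : (fun x => C g x - g x) = C (g - h) + ((fun x => C h x - h x) + (h - g)) := by
    have h1 : C g = C (g - h) + C h := by
      have := ConvolutionExists.distrib_add (hcex (hghp.locallyIntegrable hp1))
        (hcex (hhp.locallyIntegrable hp1))
      rw [sub_add_cancel] at this
      exact this
    ext x
    simp only [h1, Pi.add_apply, Pi.sub_apply]
    abel
  have hCm : ∀ {g : E → F}, MemLp g p μ → AEStronglyMeasurable (C g) μ := fun hg =>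
    ((ρ i).hasCompactSupport_normed.continuous_convolution_left _ (ρ i).continuous_normed
      (hg.locallyIntegrable hp1)).aestronglyMeasurable
  have hclose : ∀ x, ‖C h x - h x‖ ≤ c := by
    intro x
    rw [← dist_eq_norm]
    refine (ρ i).dist_normed_convolution_le hhc.aestronglyMeasurable fun y hy => ?_
    exact (hηc (hy.trans (hi.trans_le (min_le_left _ _)))).le
  have hzero : ∀ x ∉ K, C h x - h x = 0 := by
    intro x hx
    have h0 : ∀ y ∈ Metric.ball x (ρ i).rOut, h y = 0 := by
      intro y hy
      by_contra hne
      refine hx (Metric.mem_cthickening_of_dist_le x y 1 _ (subset_tsupport _ hne) ?_)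
      rw [dist_comm]
      exact (hy.trans (hi.trans_le (min_le_right _ _))).le
    have hx0 := h0 x (Metric.mem_ball_self (ρ i).rOut_pos)
    have := (ρ i).normed_convolution_eq_right (μ := μ) (g := h) (x₀ := x)
      (fun y hy => by rw [h0 y hy, hx0])
    simp only [hC, this, sub_self]
  have hmid : eLpNorm (fun x => C h x - h x) p μ ≤ δ := by
    refine le_trans ?_ hcδ
    have : eLpNorm (fun x => C h x - h x) p μ ≤ eLpNorm (K.indicator fun _ => c) p μ := by
      refine eLpNorm_mono_real fun x => ?_
      by_cases hx : x ∈ K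
      · simpa [hx] using hclose x
      · simp [hx, hzero x hx]
    refine this.trans ?_
    refine (eLpNorm_indicator_const_le c p).trans_eq ?_
    rw [Real.enorm_of_nonneg hc.le]
  rw [hsplit]
  calc eLpNorm (C (g - h) + ((fun x => C h x - h x) + (h - g))) p μ
      ≤ eLpNorm (C (g - h)) p μ + (eLpNorm (fun x => C h x - h x) p μ + eLpNorm (h - g) p μ) := by
        refine (eLpNorm_add_le (hCm hghp) ?_ hp1).trans ?_
        · exact ((hCm hhp).sub hhp.1).add (hhp.1.sub hg.1)
        gcongr
        exact eLpNorm_add_le ((hCm hhp).sub hhp.1) (hhp.1.sub hg.1) hp1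
    _ ≤ δ + (δ + δ) := by
        gcongr
        · exact (eLpNorm_normed_convolution_le _ hp1 hp hghp.1).trans hhd
        · rw [eLpNorm_sub_comm]; exact hhd
    _ ≤ ε := by rwa [← add_assoc]

end Mollification

/-! ### Calculus of test functions and mollified weak gradients -/

section TestFunctions

open Filter Topology

variable {n : ℕ} {Ω : Set (EuclideanSpace ℝ (Fin n))} {ψ η : EuclideanSpace ℝ (Fin n) → ℝ}

theorem gradient_apply_eq_fderiv (ψ : EuclideanSpace ℝ (Fin n) → ℝ)
    (x : EuclideanSpace ℝ (Fin n)) (i : Fin n) :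
    gradient ψ x i = fderiv ℝ ψ x (EuclideanSpace.single i 1) := by
  rw [← toDual_gradient, InnerProductSpace.toDual_apply_apply, EuclideanSpace.inner_single_right]
  simp

theorem IsTestFunction.hasGradientAt (h : IsTestFunction Ω ψ) (x : EuclideanSpace ℝ (Fin n)) :
    HasGradientAt ψ (gradient ψ x) x :=
  (h.smooth.differentiable (by simp) x).hasGradientAt

theorem IsTestFunction.continuous_gradient (h : IsTestFunction Ω ψ) : Continuous (gradient ψ) :=
  (InnerProductSpace.toDual ℝ _).symm.continuous.comp (h.smooth.continuous_fderiv (by simp))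

theorem gradient_eq_zero_of_notMem_tsupport {x : EuclideanSpace ℝ (Fin n)} (hx : x ∉ tsupport ψ) :
    gradient ψ x = 0 := by
  rw [gradient, image_eq_zero_of_notMem_tsupport (fun h => hx (tsupport_fderiv_subset ℝ h))]
  simp

theorem IsTestFunction.hasCompactSupport_gradient (h : IsTestFunction Ω ψ) :
    HasCompactSupport (gradient ψ) :=
  HasCompactSupport.intro h.compact fun _ hx => gradient_eq_zero_of_notMem_tsupport hx

theorem IsTestFunction.exists_bound (h : IsTestFunction Ω ψ) :
    ∃ C : ℝ, 0 ≤ C ∧ (∀ x, ‖ψ x‖ ≤ C) ∧ ∀ x, ‖gradient ψ x‖ ≤ C := by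
  obtain ⟨A, hA⟩ := h.smooth.continuous.bounded_above_of_compact_support h.compact
  obtain ⟨B, hB⟩ := h.continuous_gradient.bounded_above_of_compact_support
    h.hasCompactSupport_gradient
  exact ⟨max A B, (norm_nonneg _).trans ((hA 0).trans (le_max_left _ _)),
    fun x => (hA x).trans (le_max_left _ _), fun x => (hB x).trans (le_max_right _ _)⟩

theorem IsTestFunction.mul_of_contDiff (h : IsTestFunction Ω η) (hψ : ContDiff ℝ ∞ ψ) :
    IsTestFunction Ω (fun x => η x * ψ x) where
  smooth := h.smooth.mul hψ
  compact := h.compact.mul_right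
  support := (tsupport_mul_subset_left).trans h.support

/-- Integration by parts for a test function against a smooth function. -/
theorem IsTestFunction.integral_mul_fderiv (h : IsTestFunction Ω η) (hψ : ContDiff ℝ ∞ ψ)
    (v : EuclideanSpace ℝ (Fin n)) :
    ∫ x, η x * fderiv ℝ ψ x v = -∫ x, fderiv ℝ η x v * ψ x := by
  have h1 : Continuous (fun x => fderiv ℝ η x v) :=
    (h.smooth.continuous_fderiv (by simp)).clm_apply continuous_const
  have h2 : Continuous (fun x => fderiv ℝ ψ x v) :=
    (hψ.continuous_fderiv (by simp)).clm_apply continuous_const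
  refine integral_mul_fderiv_eq_neg_fderiv_mul_of_integrable ?_ ?_ ?_
    (fun x _ => h.smooth.differentiable (by simp) x) (fun x _ => hψ.differentiable (by simp) x)
  · exact (h1.mul hψ.continuous).integrable_of_hasCompactSupport
      ((h.compact.fderiv_apply ℝ v).mul_right)
  · exact (h.smooth.continuous.mul h2).integrable_of_hasCompactSupport h.compact.mul_right
  · exact (h.smooth.continuous.mul hψ.continuous).integrable_of_hasCompactSupport
      h.compact.mul_right

/-- The gradient of a mollification is the mollification of the weak gradient. -/
theorem hasGradientAt_normed_convolution {v : EuclideanSpace ℝ (Fin n) → ℝ}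
    {V : EuclideanSpace ℝ (Fin n) → EuclideanSpace ℝ (Fin n)}
    (hv : LocallyIntegrable v) (hV : LocallyIntegrable V)
    (h : ∀ ψ, IsTestFunction Set.univ ψ → ∀ i : Fin n,
      ∫ x, v x * fderiv ℝ ψ x (EuclideanSpace.single i 1) = -∫ x, V x i * ψ x)
    (ρ : ContDiffBump (0 : EuclideanSpace ℝ (Fin n))) (x : EuclideanSpace ℝ (Fin n)) :
    HasGradientAt (convolution (ρ.normed volume) v (ContinuousLinearMap.lsmul ℝ ℝ) volume)
      (convolution (ρ.normed volume) V (ContinuousLinearMap.lsmul ℝ ℝ) volume x) x := by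
  have hd := ρ.hasCompactSupport_normed (μ := volume) |>.hasFDerivAt_convolution_left
    (ContinuousLinearMap.lsmul ℝ ℝ) (ρ.contDiff_normed (n := 1)) hv x
  rw [hasGradientAt_iff_hasFDerivAt]
  refine hd.congr_fderiv (Eq.symm ?_)
  set r := ρ.normed volume with hr
  have hrs : ContDiff ℝ ∞ r := ρ.contDiff_normed
  have hrc : HasCompactSupport r := ρ.hasCompactSupport_normed
  apply ContinuousLinearMap.coe_injective
  refine (EuclideanSpace.basisFun (Fin n) ℝ).toBasis.ext fun i => ?_
  simp only [OrthonormalBasis.coe_toBasis, EuclideanSpace.basisFun_apply,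
    ContinuousLinearMap.coe_coe]
  rw [InnerProductSpace.toDual_apply_apply, EuclideanSpace.inner_single_right]
  -- The weak identity is tested with the reflected and translated kernel; the sign from
  -- differentiating `x - y` cancels the sign of the integration by parts.
  have hψ : IsTestFunction Set.univ (fun y => r (x - y)) := by
    refine ⟨hrs.comp (contDiff_const.sub contDiff_id), ?_, Set.subset_univ _⟩
    exact hrc.comp_homeomorph (Homeomorph.subLeft x)
  have hψd : ∀ y, fderiv ℝ (fun y => r (x - y)) y (EuclideanSpace.single i 1) =
      -fderiv ℝ r (x - y) (EuclideanSpace.single i 1) := by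
    intro y
    have h1 : HasFDerivAt (fun y => x - y) (-ContinuousLinearMap.id ℝ _) y :=
      (hasFDerivAt_id y).const_sub x
    have h2 := ((hrs.differentiable (by simp) (x - y)).hasFDerivAt.comp y h1).fderiv
    have h3 : (r ∘ fun y => x - y) = fun y => r (x - y) := rfl
    rw [h3] at h2
    rw [h2]
    simp
  have key := h _ hψ i
  simp only [hψd] at key
  have hc1 : ConvolutionExistsAt r V x (ContinuousLinearMap.lsmul ℝ ℝ) volume :=
    hrc.convolutionExists_left _ hrs.continuous hV x
  have hc2 : ConvolutionExistsAt (fderiv ℝ r) v x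
      ((ContinuousLinearMap.lsmul ℝ ℝ).precompL (EuclideanSpace ℝ (Fin n))) volume :=
    (hrc.fderiv ℝ).convolutionExists_left _ (hrs.continuous_fderiv (by simp)) hv x
  have e1 : convolution r V (ContinuousLinearMap.lsmul ℝ ℝ) volume x i = ∫ y, V y i * r (x - y) := by
    rw [convolution_eq_swap]
    have hint : Integrable (fun t => r (x - t) • V t) := by
      have := hc1.integrable_swap
      simpa using this
    have := (EuclideanSpace.proj (𝕜 := ℝ) i).integral_comp_comm hint
    simp only [ContinuousLinearMap.lsmul_apply]
    have e : (∫ t, r (x - t) • V t) i = EuclideanSpace.proj (𝕜 := ℝ) i (∫ t, r (x - t) • V t) := rfl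
    rw [e, ← this]
    refine integral_congr_ae (Eventually.of_forall fun t => ?_)
    simp [mul_comm]
  have e2 : convolution (fderiv ℝ r) v
      ((ContinuousLinearMap.lsmul ℝ ℝ).precompL (EuclideanSpace ℝ (Fin n))) volume x
        (EuclideanSpace.single i 1) =
      ∫ y, v y * fderiv ℝ r (x - y) (EuclideanSpace.single i 1) := by
    rw [convolution_eq_swap]
    rw [ContinuousLinearMap.integral_apply hc2.integrable_swap]
    refine integral_congr_ae (Eventually.of_forall fun t => ?_)
    simp [mul_comm]
  rw [e1, e2]
  simp only [mul_neg, integral_neg] at key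
  simp only [conj_trivial, one_mul]
  linarith

end TestFunctions

/-! ### Cutting off Sobolev functions and closing up test functions -/

section Approximation

open Filter Topology

theorem tendsto_eLpNorm_zero_of_dominated {α E : Type*} [MeasurableSpace α]
    [NormedAddCommGroup E] {μ : Measure α} {p : ℝ≥0∞} (hp0 : p ≠ 0) (hp : p ≠ ⊤)
    {f : ℕ → α → E} {g : α → ℝ} (hf : ∀ m, AEStronglyMeasurable (f m) μ) (hg : MemLp g p μ)
    (hb : ∀ m, ∀ᵐ x ∂μ, ‖f m x‖ ≤ g x)
    (hl : ∀ᵐ x ∂μ, Tendsto (fun m => f m x) atTop (𝓝 0)) :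
    Tendsto (fun m => eLpNorm (f m) p μ) atTop (𝓝 0) := by
  have hp' : 0 < p.toReal := ENNReal.toReal_pos hp0 hp
  have key : Tendsto (fun m => ∫⁻ x, ‖f m x‖ₑ ^ p.toReal ∂μ) atTop (𝓝 (∫⁻ _, 0 ∂μ)) := by
    refine tendsto_lintegral_of_dominated_convergence' (fun x => ‖g x‖ₑ ^ p.toReal)
      (fun m => (hf m).enorm.pow_const _) (fun m => ?_)
      (lintegral_rpow_enorm_lt_top_of_eLpNorm_lt_top hp0 hp hg.2).ne ?_
    · filter_upwards [hb m] with x hx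
      gcongr
      exact enorm_le_iff_norm_le.2 (hx.trans (le_abs_self _))
    · filter_upwards [hl] with x hx
      have h1 := hx.enorm
      rw [enorm_zero] at h1
      have h2 := (ENNReal.continuous_rpow_const (y := p.toReal)).tendsto 0 |>.comp h1
      rw [ENNReal.zero_rpow_of_pos hp'] at h2
      exact h2
  simp only [lintegral_zero] at key
  have h2 := (ENNReal.continuous_rpow_const (y := 1 / p.toReal)).tendsto 0 |>.comp key
  rw [ENNReal.zero_rpow_of_pos (by positivity)] at h2
  refine h2.congr fun m => ?_
  rw [eLpNorm_eq_lintegral_rpow_enorm_toReal hp0 hp]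
  rfl

variable {n : ℕ} {Ω : Set (EuclideanSpace ℝ (Fin n))} {p : ℝ≥0∞}
  {u ψ η ζ φ : EuclideanSpace ℝ (Fin n) → ℝ}
  {Du Dφ : EuclideanSpace ℝ (Fin n) → EuclideanSpace ℝ (Fin n)}

/-- The value one is needed near `K`, not only on it, so that the gradient of the cutoff also
vanishes on `K`. -/
theorem exists_isTestFunction_eq_one (hΩ : IsOpen Ω) {K : Set (EuclideanSpace ℝ (Fin n))}
    (hK : IsCompact K) (hKΩ : K ⊆ Ω) :
    ∃ ζ, IsTestFunction Ω ζ ∧ ∀ᶠ x in 𝓝ˢ K, ζ x = 1 := by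
  obtain ⟨L, hL, hKL, hLΩ⟩ := exists_compact_between hK hΩ hKΩ
  obtain ⟨f, hf1, hf0, -⟩ := exists_contMDiffMap_one_nhds_of_subset_interior
    (n := (⊤ : ℕ∞)) (modelWithCornersSelf ℝ (EuclideanSpace ℝ (Fin n))) hK.isClosed hKL
  have hsub : tsupport f ⊆ L := closure_minimal (fun x hx => by
    by_contra h
    exact hx (hf0 x h)) hL.isClosed
  exact ⟨f, ⟨f.contMDiff.contDiff, hL.of_isClosed_subset (isClosed_tsupport _) hsub,
    hsub.trans hLΩ⟩, hf1⟩

theorem MemLp.integrable_mul_of_hasCompactSupport (hp1 : 1 ≤ p)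
    (hu : MemLp u p (volume.restrict Ω)) {g : EuclideanSpace ℝ (Fin n) → ℝ} (hg : Continuous g)
    (hgs : HasCompactSupport g) : Integrable (fun x => u x * g x) (volume.restrict Ω) := by
  have := (hu.locallyIntegrable hp1).integrable_smul_left_of_hasCompactSupport hg hgs
  simpa [mul_comm] using this

theorem MemLp.apply_euclidean {α : Type*} [MeasurableSpace α] {μ : Measure α}
    {f : α → EuclideanSpace ℝ (Fin n)} (hf : MemLp f p μ) (i : Fin n) :
    MemLp (fun x => f x i) p μ :=
  hf.of_le ((EuclideanSpace.proj (𝕜 := ℝ) i).continuous.comp_aestronglyMeasurable hf.1)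
    (Eventually.of_forall fun x => PiLp.norm_apply_le (f x) i)

/-- The product rule for the weak gradient: multiplying by a test function gives a function with
a weak gradient on the whole space. -/
theorem HasSobolevGradient.weak_mul (hu : HasSobolevGradient Ω p u Du) (hp1 : 1 ≤ p)
    (hζ : IsTestFunction Ω ζ) (hψ : ContDiff ℝ ∞ ψ) (i : Fin n) :
    ∫ x, (ζ x * u x) * fderiv ℝ ψ x (EuclideanSpace.single i 1) =
      -∫ x, (ζ x • Du x + u x • gradient ζ x) i * ψ x := by
  have hz : ∀ x ∉ Ω, x ∉ tsupport ζ := fun x hx h => hx (hζ.support h)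
  have z1 : ∀ x ∉ Ω, (ζ x * u x) * fderiv ℝ ψ x (EuclideanSpace.single i 1) = 0 := by
    intro x hx
    simp [image_eq_zero_of_notMem_tsupport (hz x hx)]
  have z2 : ∀ x ∉ Ω, (ζ x • Du x + u x • gradient ζ x) i * ψ x = 0 := by
    intro x hx
    simp [image_eq_zero_of_notMem_tsupport (hz x hx), gradient_eq_zero_of_notMem_tsupport (hz x hx)]
  rw [← setIntegral_eq_integral_of_forall_compl_eq_zero z1,
    ← setIntegral_eq_integral_of_forall_compl_eq_zero z2]
  -- Only `ζ ψ` is supported in `Ω`; `ψ` itself need not be. Expanding its derivative leaves the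
  -- extra term with the gradient of `ζ`.
  have h := hu.weak _ (hζ.mul_of_contDiff hψ) i
  set e : EuclideanSpace ℝ (Fin n) := EuclideanSpace.single i 1
  have hcζ : Continuous (fun x => fderiv ℝ ζ x e) :=
    (hζ.smooth.continuous_fderiv (by simp)).clm_apply continuous_const
  have hcψ : Continuous (fun x => fderiv ℝ ψ x e) :=
    (hψ.continuous_fderiv (by simp)).clm_apply continuous_const
  have hfd : ∀ x, fderiv ℝ (fun x => ζ x * ψ x) x e = ζ x * fderiv ℝ ψ x e + ψ x * fderiv ℝ ζ x e := by
    intro x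
    rw [fderiv_fun_mul (hζ.smooth.differentiable (by simp) x) (hψ.differentiable (by simp) x)]
    simp
  have i1 : Integrable (fun x => u x * (ζ x * fderiv ℝ ψ x e)) (volume.restrict Ω) :=
    MemLp.integrable_mul_of_hasCompactSupport hp1 hu.memLp (hζ.smooth.continuous.mul hcψ)
      hζ.compact.mul_right
  have i2 : Integrable (fun x => u x * (ψ x * fderiv ℝ ζ x e)) (volume.restrict Ω) :=
    MemLp.integrable_mul_of_hasCompactSupport hp1 hu.memLp (hψ.continuous.mul hcζ)
      (hζ.compact.fderiv_apply ℝ e).mul_left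
  have i3 : Integrable (fun x => Du x i * (ζ x * ψ x)) (volume.restrict Ω) :=
    MemLp.integrable_mul_of_hasCompactSupport hp1 (MemLp.apply_euclidean hu.memLp_grad i)
      (hζ.smooth.continuous.mul hψ.continuous) hζ.compact.mul_right
  have e1 : ∀ x, u x * fderiv ℝ (fun x => ζ x * ψ x) x e =
      u x * (ζ x * fderiv ℝ ψ x e) + u x * (ψ x * fderiv ℝ ζ x e) := by
    intro x; rw [hfd]; ring
  have e2 : ∀ x, (ζ x • Du x + u x • gradient ζ x) i * ψ x =
      Du x i * (ζ x * ψ x) + u x * (ψ x * fderiv ℝ ζ x e) := by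
    intro x
    simp only [PiLp.add_apply, PiLp.smul_apply, smul_eq_mul, gradient_apply_eq_fderiv]
    ring
  simp only [e1] at h
  simp only [e2]
  rw [integral_add i1 i2] at h
  rw [integral_add i3 i2]
  have e3 : ∀ x, ζ x * u x * fderiv ℝ ψ x e = u x * (ζ x * fderiv ℝ ψ x e) := fun x => by ring
  simp only [e3]
  linarith

theorem MemLp.test_mul (hζ : IsTestFunction Ω ζ) (hΩ : MeasurableSet Ω)
    (hu : MemLp u p (volume.restrict Ω)) : MemLp (fun x => ζ x * u x) p := by
  have hz : ∀ x ∉ Ω, x ∉ tsupport ζ := fun x hx h => hx (hζ.support h)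
  obtain ⟨C, -, hC, -⟩ := hζ.exists_bound
  have h1 : MemLp (fun x => ζ x * u x) p (volume.restrict Ω) :=
    hu.of_le_mul (c := C) (hζ.smooth.continuous.aestronglyMeasurable.mul hu.1)
      (Eventually.of_forall fun x => by
        rw [norm_mul]; exact mul_le_mul_of_nonneg_right (hC x) (norm_nonneg _))
  rw [← memLp_indicator_iff_restrict hΩ] at h1
  suffices this : (fun x => ζ x * u x) = Ω.indicator (fun x => ζ x * u x) by rwa [this]
  ext1 x
  by_cases hx : x ∈ Ω
  · simp [hx]
  · simp [hx, image_eq_zero_of_notMem_tsupport (hz x hx)]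

theorem MemLp.test_smul_add (hζ : IsTestFunction Ω ζ) (hΩ : MeasurableSet Ω)
    (hu : MemLp u p (volume.restrict Ω)) (hDu : MemLp Du p (volume.restrict Ω)) :
    MemLp (fun x => ζ x • Du x + u x • gradient ζ x) p := by
  have hz : ∀ x ∉ Ω, x ∉ tsupport ζ := fun x hx h => hx (hζ.support h)
  obtain ⟨C, -, hC, hC'⟩ := hζ.exists_bound
  have h1 : MemLp (fun x => ζ x • Du x) p (volume.restrict Ω) :=
    hDu.of_le_mul (c := C) (hζ.smooth.continuous.aestronglyMeasurable.smul hDu.1)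
      (Eventually.of_forall fun x => by
        rw [norm_smul]; exact mul_le_mul_of_nonneg_right (hC x) (norm_nonneg _))
  have h2 : MemLp (fun x => u x • gradient ζ x) p (volume.restrict Ω) :=
    hu.of_le_mul (c := C) (hu.1.smul hζ.continuous_gradient.aestronglyMeasurable)
      (Eventually.of_forall fun x => by
        rw [norm_smul, mul_comm]; exact mul_le_mul_of_nonneg_right (hC' x) (norm_nonneg _))
  have h3 := (memLp_indicator_iff_restrict hΩ).2 (h1.add h2)
  suffices this : (fun x => ζ x • Du x + u x • gradient ζ x) =
      Ω.indicator ((fun x => ζ x • Du x) + fun x => u x • gradient ζ x) by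
    rwa [this]
  ext1 x
  by_cases hx : x ∈ Ω
  · simp [hx]
  · simp [hx, image_eq_zero_of_notMem_tsupport (hz x hx),
      gradient_eq_zero_of_notMem_tsupport (hz x hx)]

theorem enorm_integral_mul_le {α : Type*} [MeasurableSpace α] {μ : Measure α} {f g : α → ℝ}
    {p q : ℝ≥0∞} [ENNReal.HolderConjugate p q] (hf : AEStronglyMeasurable f μ)
    (hg : AEStronglyMeasurable g μ) :
    ‖∫ x, f x * g x ∂μ‖ₑ ≤ eLpNorm f p μ * eLpNorm g q μ := by
  refine (enorm_integral_le_lintegral_enorm _).trans ?_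
  rw [← eLpNorm_one_eq_lintegral_enorm]
  have := eLpNorm_smul_le_mul_eLpNorm (p := p) (q := q) (r := 1) (𝕜 := ℝ) hg hf
  exact this

/-- A limit of test functions in the norm of `W^{1,p}` belongs to `W₀^{1,p}`. -/
theorem HasSobolevGradientZero.of_approx (hp1 : 1 ≤ p)
    (hφ : MemLp φ p (volume.restrict Ω)) (hDφ : MemLp Dφ p (volume.restrict Ω))
    (h : ∀ ε : ℝ≥0∞, 0 < ε → ∃ ψ, IsTestFunction Ω ψ ∧
      eLpNorm (fun x => φ x - ψ x) p (volume.restrict Ω) +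
        eLpNorm (fun x => Dφ x - gradient ψ x) p (volume.restrict Ω) ≤ ε) :
    HasSobolevGradientZero Ω p φ Dφ := by
  refine ⟨⟨hφ, hDφ, fun χ hχ i => ?_⟩, h⟩
  set e : EuclideanSpace ℝ (Fin n) := EuclideanSpace.single i 1
  have : Fact (1 ≤ p) := ⟨hp1⟩
  have hconj : ENNReal.HolderConjugate p (ENNReal.conjExponent p) :=
    ENNReal.HolderConjugate.conjExponent hp1
  set q := ENNReal.conjExponent p
  have hcχ : Continuous (fun x => fderiv ℝ χ x e) :=
    (hχ.smooth.continuous_fderiv (by simp)).clm_apply continuous_const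
  have hsχ : HasCompactSupport (fun x => fderiv ℝ χ x e) := hχ.compact.fderiv_apply ℝ e
  have hq1 : eLpNorm (fun x => fderiv ℝ χ x e) q (volume.restrict Ω) ≠ ⊤ :=
    ((hcχ.memLp_of_hasCompactSupport hsχ (p := q)).restrict Ω).2.ne
  have hq2 : eLpNorm χ q (volume.restrict Ω) ≠ ⊤ :=
    ((hχ.smooth.continuous.memLp_of_hasCompactSupport hχ.compact (p := q)).restrict Ω).2.ne
  have hz : ∀ x ∉ Ω, x ∉ tsupport χ := fun x hx h => hx (hχ.support h)
  rw [← sub_eq_zero, sub_neg_eq_add, ← enorm_eq_zero, ← nonpos_iff_eq_zero]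
  -- Test functions integrate by parts exactly, so the defect for `φ` equals the defect for `φ - ψ`,
  -- which Hölder's inequality with the conjugate exponent makes small.
  have bound : ∀ ε : ℝ≥0∞, 0 < ε →
      ‖∫ x in Ω, φ x * fderiv ℝ χ x e‖ₑ = ‖∫ x in Ω, φ x * fderiv ℝ χ x e‖ₑ →
      ‖(∫ x in Ω, φ x * fderiv ℝ χ x e) + ∫ x in Ω, Dφ x i * χ x‖ₑ ≤
        ε * (eLpNorm (fun x => fderiv ℝ χ x e) q (volume.restrict Ω) +
          eLpNorm χ q (volume.restrict Ω)) := by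
    intro ε hε _
    obtain ⟨ψ, hψ, hψε⟩ := h ε hε
    have hψp : MemLp ψ p (volume.restrict Ω) :=
      (hψ.smooth.continuous.memLp_of_hasCompactSupport hψ.compact).restrict Ω
    have hgp : MemLp (gradient ψ) p (volume.restrict Ω) :=
      (hψ.continuous_gradient.memLp_of_hasCompactSupport hψ.hasCompactSupport_gradient).restrict Ω
    have ibp : (∫ x in Ω, ψ x * fderiv ℝ χ x e) + ∫ x in Ω, gradient ψ x i * χ x = 0 := by
      rw [setIntegral_eq_integral_of_forall_compl_eq_zero,
        setIntegral_eq_integral_of_forall_compl_eq_zero]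
      · simp only [gradient_apply_eq_fderiv]
        rw [hψ.integral_mul_fderiv hχ.smooth]
        exact neg_add_cancel _
      · intro x hx
        simp [image_eq_zero_of_notMem_tsupport (hz x hx)]
      · intro x hx
        have := gradient_eq_zero_of_notMem_tsupport (hz x hx)
        rw [← gradient_apply_eq_fderiv, this]
        simp
    have s1 : ∫ x in Ω, (φ x - ψ x) * fderiv ℝ χ x e =
        (∫ x in Ω, φ x * fderiv ℝ χ x e) - ∫ x in Ω, ψ x * fderiv ℝ χ x e := by
      simp only [sub_mul]
      exact integral_sub (MemLp.integrable_mul_of_hasCompactSupport hp1 hφ hcχ hsχ)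
        (MemLp.integrable_mul_of_hasCompactSupport hp1 hψp hcχ hsχ)
    have s2 : ∫ x in Ω, (Dφ x - gradient ψ x) i * χ x =
        (∫ x in Ω, Dφ x i * χ x) - ∫ x in Ω, gradient ψ x i * χ x := by
      simp only [PiLp.sub_apply, sub_mul]
      exact integral_sub (MemLp.integrable_mul_of_hasCompactSupport hp1
          (MemLp.apply_euclidean hDφ i) hχ.smooth.continuous hχ.compact)
        (MemLp.integrable_mul_of_hasCompactSupport hp1 (MemLp.apply_euclidean hgp i)
          hχ.smooth.continuous hχ.compact)
    have eq : (∫ x in Ω, φ x * fderiv ℝ χ x e) + ∫ x in Ω, Dφ x i * χ x =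
        (∫ x in Ω, (φ x - ψ x) * fderiv ℝ χ x e) + ∫ x in Ω, (Dφ x - gradient ψ x) i * χ x := by
      rw [s1, s2]; linarith
    rw [eq]
    have hsub := hDφ.sub hgp
    calc _ ≤ ‖∫ x in Ω, (φ x - ψ x) * fderiv ℝ χ x e‖ₑ +
          ‖∫ x in Ω, (Dφ x - gradient ψ x) i * χ x‖ₑ := enorm_add_le _ _
      _ ≤ eLpNorm (fun x => φ x - ψ x) p (volume.restrict Ω) *
            eLpNorm (fun x => fderiv ℝ χ x e) q (volume.restrict Ω) +
          eLpNorm (fun x => (Dφ x - gradient ψ x) i) p (volume.restrict Ω) *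
            eLpNorm χ q (volume.restrict Ω) := by
        gcongr
        · exact enorm_integral_mul_le (hφ.sub hψp).1 hcχ.aestronglyMeasurable
        · exact enorm_integral_mul_le (MemLp.apply_euclidean hsub i).1
            hχ.smooth.continuous.aestronglyMeasurable
      _ ≤ ε * eLpNorm (fun x => fderiv ℝ χ x e) q (volume.restrict Ω) +
          ε * eLpNorm χ q (volume.restrict Ω) := by
        gcongr
        · exact le_self_add.trans hψε
        · refine (eLpNorm_mono fun x => ?_).trans (le_add_self.trans hψε)
          exact PiLp.norm_apply_le _ i
      _ = _ := by rw [mul_add]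
  refine le_of_forall_gt_imp_ge_of_dense fun ε hε => ?_
  set S := eLpNorm (fun x => fderiv ℝ χ x e) q (volume.restrict Ω) +
    eLpNorm χ q (volume.restrict Ω) with hS
  by_cases hεt : ε = ⊤
  · simp [hεt]
  have hSt : S + 1 ≠ ⊤ := by simp [hS, hq1, hq2]
  refine (bound (ε / (S + 1)) (ENNReal.div_pos hε.ne' hSt) rfl).trans ?_
  calc ε / (S + 1) * S ≤ ε / (S + 1) * (S + 1) := by gcongr; exact le_self_add
    _ = ε := ENNReal.div_mul_cancel (by simp) hSt

end Approximation

/-! ### Chain rule and Sobolev inequality in `W₀^{1,p}` -/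

section ChainRule

open Filter Topology

variable {n : ℕ} {Ω : Set (EuclideanSpace ℝ (Fin n))} {p : ℝ≥0∞}
  {u η φ : EuclideanSpace ℝ (Fin n) → ℝ}
  {Du Dφ : EuclideanSpace ℝ (Fin n) → EuclideanSpace ℝ (Fin n)}

theorem IsTestFunction.hasGradientAt_mul_comp (hη : IsTestFunction Ω η) {G : ℝ → ℝ}
    (hG : ContDiff ℝ ∞ G) {w : EuclideanSpace ℝ (Fin n) → ℝ} {W x : EuclideanSpace ℝ (Fin n)}
    (hw : HasGradientAt w W x) :
    HasGradientAt (fun x => η x * G (w x))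
      ((η x * deriv G (w x)) • W + G (w x) • gradient η x) x := by
  have h1 := (hη.hasGradientAt x).hasFDerivAt
  have h2 := (hG.differentiable (by simp) (w x)).hasDerivAt.comp_hasFDerivAt x hw.hasFDerivAt
  have h3 := h1.mul h2
  rw [hasGradientAt_iff_hasFDerivAt]
  refine h3.congr_fderiv ?_
  simp only [map_add, map_smul, smul_smul, Function.comp_apply]

/-- The chain and product rules: `η G(u)` belongs to `W₀^{1,p}`. -/
theorem HasSobolevGradient.mul_comp (hΩ : IsOpen Ω) (hp1 : 1 ≤ p) (hp : p ≠ ⊤)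
    (hu : HasSobolevGradient Ω p u Du) (hη : IsTestFunction Ω η) {G : ℝ → ℝ}
    (hG : ContDiff ℝ ∞ G) (hG0 : G 0 = 0) {B : ℝ} (hB : ∀ t, |deriv G t| ≤ B) :
    HasSobolevGradientZero Ω p (fun x => η x * G (u x))
      (fun x => (η x * deriv G (u x)) • Du x + G (u x) • gradient η x) := by
  have hp0 : p ≠ 0 := (zero_lt_one.trans_le hp1).ne'
  have hB0 : 0 ≤ B := (abs_nonneg _).trans (hB 0)
  have hLip : ∀ s t, |G s - G t| ≤ B * |s - t| := fun s t => by
    have := Convex.norm_image_sub_le_of_norm_deriv_le (f := G) (C := B) (s := Set.univ)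
      (fun x _ => hG.differentiable (by simp) x) (fun x _ => hB x) convex_univ
      (Set.mem_univ t) (Set.mem_univ s)
    simpa using this
  have hGc : Continuous G := hG.continuous
  have hG'c : Continuous (deriv G) := hG.continuous_deriv (by simp)
  obtain ⟨A, hA0, hA, hA'⟩ := hη.exists_bound
  -- Multiplying by `ζ` extends `u` to the whole space without changing it or its gradient on the
  -- support of `η`, so it can be mollified freely.
  obtain ⟨ζ, hζ, hζ1⟩ := exists_isTestFunction_eq_one hΩ hη.compact.isCompact hη.support
  set v : EuclideanSpace ℝ (Fin n) → ℝ := fun x => ζ x * u x with hv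
  set V : EuclideanSpace ℝ (Fin n) → EuclideanSpace ℝ (Fin n) :=
    fun x => ζ x • Du x + u x • gradient ζ x with hV
  have hvp : MemLp v p := MemLp.test_mul hζ hΩ.measurableSet hu.memLp
  have hVp : MemLp V p := MemLp.test_smul_add hζ hΩ.measurableSet hu.memLp hu.memLp_grad
  have hvl := hvp.locallyIntegrable hp1
  have hVl := hVp.locallyIntegrable hp1
  have hmem : ∀ x, x ∈ tsupport η → v x = u x ∧ V x = Du x := by
    intro x hx
    have h1 : ∀ᶠ y in 𝓝 x, ζ y = 1 := hζ1.filter_mono (nhds_le_nhdsSet hx)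
    have h2 : gradient ζ x = 0 := by
      have : ζ =ᶠ[𝓝 x] fun _ => 1 := h1
      rw [gradient, this.fderiv_eq]
      simp
    simp [hv, hV, h1.self_of_nhds, h2]
  have hφ : (fun x => η x * G (u x)) = fun x => η x * G (v x) := by
    ext1 x
    by_cases hx : x ∈ tsupport η
    · rw [(hmem x hx).1]
    · simp [image_eq_zero_of_notMem_tsupport hx]
  have hDφ : (fun x => (η x * deriv G (u x)) • Du x + G (u x) • gradient η x) =
      fun x => (η x * deriv G (v x)) • V x + G (v x) • gradient η x := by
    ext1 x
    by_cases hx : x ∈ tsupport η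
    · rw [(hmem x hx).1, (hmem x hx).2]
    · simp [image_eq_zero_of_notMem_tsupport hx, gradient_eq_zero_of_notMem_tsupport hx]
  rw [hφ, hDφ]
  have hGv : AEStronglyMeasurable (fun x => G (v x)) volume :=
    hGc.comp_aestronglyMeasurable hvp.1
  have hG'v : AEStronglyMeasurable (fun x => deriv G (v x)) volume :=
    hG'c.comp_aestronglyMeasurable hvp.1
  have hηm : AEStronglyMeasurable η volume := hη.smooth.continuous.aestronglyMeasurable
  have hηm' : AEStronglyMeasurable (gradient η) volume := hη.continuous_gradient.aestronglyMeasurable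
  have hGb : ∀ t, |G t| ≤ B * |t| := fun t => by simpa [hG0] using hLip t 0
  have hφp : MemLp (fun x => η x * G (v x)) p volume :=
    hvp.of_le_mul (c := A * B) (hηm.mul hGv) (Eventually.of_forall fun x => by
      rw [norm_mul, mul_assoc]
      exact mul_le_mul (hA x) (hGb _) (norm_nonneg _) hA0)
  have hDφp : MemLp (fun x => (η x * deriv G (v x)) • V x + G (v x) • gradient η x) p volume := by
    refine MemLp.add ?_ ?_
    · refine hVp.of_le_mul (c := A * B) ((hηm.mul hG'v).smul hVp.1) (Eventually.of_forall fun x => ?_)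
      rw [norm_smul, norm_mul]
      gcongr
      · exact hA x
      · exact hB _
    · refine hvp.of_le_mul (c := A * B) (hGv.smul hηm') (Eventually.of_forall fun x => ?_)
      rw [norm_smul, mul_comm, mul_assoc]
      exact mul_le_mul (hA' x) (hGb _) (norm_nonneg _) hA0
  refine HasSobolevGradientZero.of_approx hp1 (hφp.restrict Ω) (hDφp.restrict Ω) fun ε hε => ?_
  -- The outer radius is a fixed multiple of the inner one, as the almost everywhere convergence of
  -- the mollifications requires.
  let ρ : ℕ → ContDiffBump (0 : EuclideanSpace ℝ (Fin n)) := fun m =>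
    ⟨1 / ((m : ℝ) + 1), 2 * (1 / ((m : ℝ) + 1)), by positivity, by
      have : 0 < 1 / ((m : ℝ) + 1) := by positivity
      linarith⟩
  have hρ : Tendsto (fun m => (ρ m).rOut) atTop (𝓝 0) := by
    have := (tendsto_one_div_add_atTop_nhds_zero_nat (𝕜 := ℝ)).const_mul 2
    rwa [mul_zero] at this
  set vm : ℕ → EuclideanSpace ℝ (Fin n) → ℝ := fun m =>
    convolution ((ρ m).normed volume) v (ContinuousLinearMap.lsmul ℝ ℝ) volume with hvm
  set Vm : ℕ → EuclideanSpace ℝ (Fin n) → EuclideanSpace ℝ (Fin n) := fun m =>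
    convolution ((ρ m).normed volume) V (ContinuousLinearMap.lsmul ℝ ℝ) volume with hVm
  have hsm : ∀ m, ContDiff ℝ ∞ (vm m) := fun m =>
    (ρ m).hasCompactSupport_normed.contDiff_convolution_left _ (ρ m).contDiff_normed hvl
  have hcV : ∀ m, Continuous (Vm m) := fun m =>
    (ρ m).hasCompactSupport_normed.continuous_convolution_left _ (ρ m).continuous_normed hVl
  have hgrad : ∀ m x, HasGradientAt (vm m) (Vm m x) x := fun m x =>
    hasGradientAt_normed_convolution hvl hVl
      (fun ψ hψ i => hu.weak_mul hp1 hζ hψ.smooth i) (ρ m) x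
  have htest : ∀ m, IsTestFunction Ω (fun x => η x * G (vm m x)) := fun m =>
    hη.mul_of_contDiff (hG.comp (hsm m))
  have hgt : ∀ m x, gradient (fun x => η x * G (vm m x)) x =
      (η x * deriv G (vm m x)) • Vm m x + G (vm m x) • gradient η x := fun m x =>
    (hη.hasGradientAt_mul_comp hG (hgrad m x)).gradient
  have t1 := tendsto_eLpNorm_normed_convolution_sub hp1 hp hvp hρ
  have t2 := tendsto_eLpNorm_normed_convolution_sub hp1 hp hVp hρ
  have hae : ∀ᵐ x, Tendsto (fun m => vm m x) atTop (𝓝 (v x)) :=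
    ContDiffBump.ae_convolution_tendsto_right_of_locallyIntegrable hρ (K := 2)
      (Eventually.of_forall fun m => le_rfl) hvl
  have hmG' : ∀ m, AEStronglyMeasurable (fun x => (deriv G (v x) - deriv G (vm m x)) • V x) volume :=
    fun m => (hG'v.sub (hG'c.comp (hsm m).continuous).aestronglyMeasurable).smul hVp.1
  -- `G'` is merely bounded and continuous here, so this term needs dominated convergence; the
  -- others follow from the Lipschitz bound on `G`, the bound on `G'` and convergence in `L^p`.
  have t3 : Tendsto (fun m => eLpNorm (fun x => (deriv G (v x) - deriv G (vm m x)) • V x) p volume)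
      atTop (𝓝 0) := by
    refine tendsto_eLpNorm_zero_of_dominated hp0 hp (g := fun x => (2 * B) * ‖V x‖) hmG'
      (hVp.norm.const_mul _) (fun m => Eventually.of_forall fun x => ?_) ?_
    · rw [norm_smul]
      gcongr
      refine (norm_sub_le _ _).trans ?_
      have h1 := hB (v x)
      have h2 := hB (vm m x)
      simp only [Real.norm_eq_abs]
      linarith
    · filter_upwards [hae] with x hx
      have h1 := (hG'c.tendsto (v x)).comp hx
      have h2 := (tendsto_const_nhds (x := deriv G (v x))).sub h1
      rw [sub_self] at h2
      have h3 := h2.smul_const (V x)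
      rw [zero_smul] at h3
      exact h3
  set a := ENNReal.ofReal A
  set b := ENNReal.ofReal (A * B)
  have bound : ∀ m, eLpNorm (fun x => η x * G (v x) - η x * G (vm m x)) p (volume.restrict Ω) +
      eLpNorm (fun x => ((η x * deriv G (v x)) • V x + G (v x) • gradient η x) -
        gradient (fun x => η x * G (vm m x)) x) p (volume.restrict Ω) ≤
      b * eLpNorm (fun x => vm m x - v x) p volume +
      (a * eLpNorm (fun x => (deriv G (v x) - deriv G (vm m x)) • V x) p volume +
        (b * eLpNorm (fun x => Vm m x - V x) p volume +
          b * eLpNorm (fun x => vm m x - v x) p volume)) := by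
    intro m
    have hvmm : AEStronglyMeasurable (vm m) volume := (hsm m).continuous.aestronglyMeasurable
    have hVmm : AEStronglyMeasurable (Vm m) volume := (hcV m).aestronglyMeasurable
    refine add_le_add ?_ ?_
    · refine (eLpNorm_mono_measure _ Measure.restrict_le_self).trans ?_
      refine eLpNorm_le_mul_eLpNorm_of_ae_le_mul (Eventually.of_forall fun x => ?_) p
      rw [← mul_sub, norm_mul, mul_assoc]
      refine mul_le_mul (hA x) ?_ (norm_nonneg _) hA0
      rw [norm_sub_rev]
      exact hLip _ _
    · refine (eLpNorm_mono_measure _ Measure.restrict_le_self).trans ?_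
      have hG'vm : AEStronglyMeasurable (fun x => deriv G (vm m x)) volume :=
        (hG'c.comp (hsm m).continuous).aestronglyMeasurable
      have hGvm : AEStronglyMeasurable (fun x => G (vm m x)) volume :=
        (hGc.comp (hsm m).continuous).aestronglyMeasurable
      set f1 := fun x => η x • ((deriv G (v x) - deriv G (vm m x)) • V x) with hf1
      set f2 := fun x => (η x * deriv G (vm m x)) • (V x - Vm m x) with hf2
      set f3 := fun x => (G (v x) - G (vm m x)) • gradient η x with hf3
      have m1 : AEStronglyMeasurable f1 volume := hηm.smul (hmG' m)
      have m2 : AEStronglyMeasurable f2 volume := (hηm.mul hG'vm).smul (hVp.1.sub hVmm)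
      have m3 : AEStronglyMeasurable f3 volume := (hGv.sub hGvm).smul hηm'
      have heq : (fun x => ((η x * deriv G (v x)) • V x + G (v x) • gradient η x) -
          gradient (fun x => η x * G (vm m x)) x) = f1 + (f2 + f3) := by
        ext1 x
        simp only [hgt, hf1, hf2, hf3, Pi.add_apply]
        module
      rw [heq]
      refine (eLpNorm_add_le m1 (m2.add m3) hp1).trans (add_le_add ?_
        ((eLpNorm_add_le m2 m3 hp1).trans (add_le_add ?_ ?_)))
      · refine eLpNorm_le_mul_eLpNorm_of_ae_le_mul (Eventually.of_forall fun x => ?_) p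
        simp only [hf1]
        rw [norm_smul]
        gcongr
        exact hA x
      · refine eLpNorm_le_mul_eLpNorm_of_ae_le_mul (Eventually.of_forall fun x => ?_) p
        simp only [hf2]
        rw [norm_smul, norm_mul, norm_sub_rev]
        gcongr
        · exact hA x
        · exact hB _
      · refine eLpNorm_le_mul_eLpNorm_of_ae_le_mul (Eventually.of_forall fun x => ?_) p
        simp only [hf3]
        rw [norm_smul, mul_comm, mul_assoc]
        refine mul_le_mul (hA' x) ?_ (norm_nonneg _) hA0
        rw [norm_sub_rev]
        exact hLip _ _
  have hlim : Tendsto (fun m => b * eLpNorm (fun x => vm m x - v x) p volume +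
      (a * eLpNorm (fun x => (deriv G (v x) - deriv G (vm m x)) • V x) p volume +
        (b * eLpNorm (fun x => Vm m x - V x) p volume +
          b * eLpNorm (fun x => vm m x - v x) p volume))) atTop (𝓝 0) := by
    have c1 := ENNReal.Tendsto.const_mul (a := b) t1 (Or.inr ENNReal.ofReal_ne_top)
    have c2 := ENNReal.Tendsto.const_mul (a := b) t2 (Or.inr ENNReal.ofReal_ne_top)
    have c3 := ENNReal.Tendsto.const_mul (a := a) t3 (Or.inr ENNReal.ofReal_ne_top)
    have := c1.add (c3.add (c2.add c1))
    simpa using this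
  obtain ⟨m, hm⟩ := (ENNReal.tendsto_nhds_zero.1 hlim ε hε).exists
  exact ⟨_, htest m, (bound m).trans hm⟩

/-- The Gagliardo-Nirenberg-Sobolev inequality in `W₀^{1,p}`. -/
theorem HasSobolevGradientZero.eLpNorm_le [IsFiniteMeasure (volume.restrict Ω)] (hn : 0 < n)
    (hp : p ≠ ⊤) (h : HasSobolevGradientZero Ω p φ Dφ) {r τ : NNReal} (hr1 : 1 ≤ r)
    (hrp : (r : ℝ≥0∞) ≤ p) (hτ : (τ : ℝ)⁻¹ = (r : ℝ)⁻¹ - (n : ℝ)⁻¹) :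
    eLpNorm φ τ (volume.restrict Ω) ≤
      SNormLESNormFDerivOfEqConst ℝ (volume : Measure (EuclideanSpace ℝ (Fin n))) r *
        eLpNorm Dφ r (volume.restrict Ω) := by
  have hp1 : 1 ≤ p := le_trans (by exact_mod_cast hr1) hrp
  have hp0 : p ≠ 0 := (zero_lt_one.trans_le hp1).ne'
  set c := SNormLESNormFDerivOfEqConst ℝ (volume : Measure (EuclideanSpace ℝ (Fin n))) r
  set μ := volume.restrict Ω with hμ
  -- The approximation is in the `L^p` norm, while the Sobolev inequality is wanted with `L^r`; this
  -- is the price of passing from `p` to `r ≤ p`.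
  set κ := μ Set.univ ^ (1 / (r : ℝ≥0∞).toReal - 1 / p.toReal) with hκ
  have hκt : κ ≠ ⊤ := by
    refine ENNReal.rpow_ne_top_of_nonneg ?_ (measure_ne_top _ _)
    rw [sub_nonneg]
    exact one_div_le_one_div_of_le (by simpa using zero_lt_one.trans_le hr1)
      (ENNReal.toReal_mono hp hrp)
  have hε : ∀ m : ℕ, (0 : ℝ≥0∞) < ((m : ℝ≥0∞) + 1)⁻¹ := fun m => by simp
  choose ψ hψ hψε using fun m : ℕ => h.approx _ (hε m)
  have hlim : Tendsto (fun m : ℕ => ((m : ℝ≥0∞) + 1)⁻¹) atTop (𝓝 0) := by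
    have := (ENNReal.tendsto_inv_nat_nhds_zero).comp (tendsto_add_atTop_nat 1)
    refine this.congr fun m => by simp
  have hψm : ∀ m, AEStronglyMeasurable (ψ m) μ := fun m =>
    (hψ m).smooth.continuous.aestronglyMeasurable
  have ht : Tendsto (fun m => eLpNorm (ψ m - φ) p μ) atTop (𝓝 0) := by
    refine tendsto_of_tendsto_of_tendsto_of_le_of_le tendsto_const_nhds hlim (fun _ => zero_le)
      fun m => ?_
    rw [eLpNorm_sub_comm]
    exact le_self_add.trans (hψε m)
  -- Convergence in `L^p` gives a subsequence converging almost everywhere, and Fatou's lemma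
  -- carries the `L^τ` bound to the limit.
  obtain ⟨ns, hns, hae⟩ := (tendstoInMeasure_of_tendsto_eLpNorm hp0 hψm h.memLp.1
    ht).exists_seq_tendsto_ae
  refine (Lp.eLpNorm_lim_le_liminf_eLpNorm (fun m => hψm (ns m)) φ hae).trans ?_
  have hb : ∀ m, eLpNorm (ψ m) τ μ ≤ c * (eLpNorm Dφ r μ + ((m : ℝ≥0∞) + 1)⁻¹ * κ) := by
    intro m
    have hg := (hψ m).continuous_gradient.aestronglyMeasurable (μ := μ)
    refine (eLpNorm_mono_measure _ Measure.restrict_le_self).trans ?_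
    have h1 := eLpNorm_le_eLpNorm_fderiv_of_eq (volume : Measure (EuclideanSpace ℝ (Fin n)))
      ((hψ m).smooth.of_le (by simp)) (hψ m).compact hr1 (by simpa using hn) (p' := τ)
      (by simpa using hτ)
    refine h1.trans ?_
    gcongr
    have h2 : eLpNorm (fderiv ℝ (ψ m)) r volume = eLpNorm (gradient (ψ m)) r μ := by
      rw [hμ, eLpNorm_restrict_eq_of_support_subset]
      · refine eLpNorm_congr_norm_ae (Eventually.of_forall fun x => ?_)
        rw [gradient, LinearIsometryEquiv.norm_map]
      · intro x hx
        by_contra hxΩ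
        exact hx (gradient_eq_zero_of_notMem_tsupport fun hxt => hxΩ ((hψ m).support hxt))
    rw [h2]
    have h3 : gradient (ψ m) = Dφ - (fun x => Dφ x - gradient (ψ m) x) := by
      ext1 x; simp
    rw [h3]
    refine (eLpNorm_sub_le h.memLp_grad.1 (h.memLp_grad.1.sub hg)
      (by exact_mod_cast hr1)).trans ?_
    gcongr
    refine (eLpNorm_le_eLpNorm_mul_rpow_measure_univ hrp (h.memLp_grad.1.sub hg)).trans ?_
    gcongr
    exact le_add_self.trans (hψε m)
  have hlim2 : Tendsto (fun m => (c : ℝ≥0∞) * (eLpNorm Dφ r μ + ((ns m : ℝ≥0∞) + 1)⁻¹ * κ)) atTop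
      (𝓝 (c * (eLpNorm Dφ r μ + 0 * κ))) := by
    refine ENNReal.Tendsto.const_mul (tendsto_const_nhds.add ?_) (Or.inr ENNReal.coe_ne_top)
    exact ENNReal.Tendsto.mul_const (hlim.comp hns.tendsto_atTop) (Or.inr hκt)
  rw [zero_mul, add_zero] at hlim2
  rw [← hlim2.liminf_eq]
  exact liminf_le_liminf (Eventually.of_forall fun m => hb (ns m))

end ChainRule

/-! ### Smooth truncations and radial cutoffs -/

section Cutoff

open Filter Topology

/-- The primitive of the smooth transition works. Its derivative is increasing, whence `R t ≤ t R'
t`, and equals one beyond `t = 1`, whence `t - 1 ≤ R t`. -/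
theorem exists_smooth_ramp : ∃ R : ℝ → ℝ, ContDiff ℝ ∞ R ∧ (∀ t, 0 ≤ R t) ∧
    (∀ t ≤ 0, R t = 0) ∧ (∀ t, 0 ≤ deriv R t ∧ deriv R t ≤ 1) ∧ (∀ t, R t ≤ t * deriv R t) ∧
    ∀ t, t - 1 ≤ R t := by
  set S := Real.smoothTransition
  have hSc : Continuous S := Real.smoothTransition.continuous
  have hint : ∀ a b, IntervalIntegrable S volume a b := fun a b => hSc.intervalIntegrable a b
  have hd : ∀ t, HasDerivAt (fun t => ∫ s in (0 : ℝ)..t, S s) (S t) t := fun t =>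
    intervalIntegral.integral_hasDerivAt_right (hint 0 t)
      (hSc.stronglyMeasurableAtFilter _ _) hSc.continuousAt
  have hderiv : deriv (fun t => ∫ s in (0 : ℝ)..t, S s) = S := funext fun t => (hd t).deriv
  have hneg : ∀ t ≤ 0, ∫ s in (0 : ℝ)..t, S s = 0 := by
    intro t ht
    rw [intervalIntegral.integral_symm, intervalIntegral.integral_congr (g := fun _ => (0 : ℝ))]
    · simp
    · intro s hs
      rw [Set.uIcc_of_le ht] at hs
      exact Real.smoothTransition.zero_of_nonpos hs.2
  have hpos : ∀ t, 0 ≤ ∫ s in (0 : ℝ)..t, S s := by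
    intro t
    rcases le_total t 0 with ht | ht
    · exact (hneg t ht).ge
    · exact intervalIntegral.integral_nonneg ht fun s _ => Real.smoothTransition.nonneg s
  refine ⟨fun t => ∫ s in (0 : ℝ)..t, S s, ?_, hpos, hneg, fun t => ?_, fun t => ?_, fun t => ?_⟩
  · rw [contDiff_infty_iff_deriv]
    refine ⟨fun t => (hd t).differentiableAt, ?_⟩
    rw [hderiv]
    exact Real.smoothTransition.contDiff
  · rw [hderiv]
    exact ⟨Real.smoothTransition.nonneg t, Real.smoothTransition.le_one t⟩
  · rw [hderiv]
    beta_reduce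
    rcases le_total t 0 with ht | ht
    · rw [hneg t ht, show S t = 0 from Real.smoothTransition.zero_of_nonpos ht, mul_zero]
    · have := intervalIntegral.integral_mono_on ht (hint 0 t)
        (intervalIntegrable_const (c := S t)) fun s hs => Real.smoothTransition.monotone hs.2
      simpa using this
  · beta_reduce
    rcases le_total t 1 with ht | ht
    · linarith [hpos t]
    · rw [← intervalIntegral.integral_add_adjacent_intervals (hint 0 1) (hint 1 t)]
      have h1 : ∫ s in (1 : ℝ)..t, S s = t - 1 := by
        rw [intervalIntegral.integral_congr (g := fun _ => (1 : ℝ))]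
        · simp
        · intro s hs
          rw [Set.uIcc_of_le ht] at hs
          exact Real.smoothTransition.one_of_one_le hs.1
      rw [h1]
      linarith [hpos 1]

/-- A smooth convex function between `(t - k)⁺` and `(t - h)⁺`. -/
theorem exists_smooth_truncation {h k : ℝ} (h0 : 0 ≤ h) (hk : h < k) :
    ∃ H : ℝ → ℝ, ContDiff ℝ ∞ H ∧ H 0 = 0 ∧ (∀ t, 0 ≤ H t) ∧
      (∀ t, 0 ≤ deriv H t ∧ deriv H t ≤ 1) ∧ (∀ t, H t ≤ max (t - h) 0 * deriv H t) ∧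
      (∀ t, max (t - k) 0 ≤ H t) ∧ ∀ t, H t ≠ 0 → (k - h) / 2 ≤ t - h := by
  obtain ⟨R, hR, hR0, hRneg, hR', hRt, hR1⟩ := exists_smooth_ramp
  -- The ramp is scaled to start at the midpoint `m` of the levels and to have slope one beyond `k =
  -- m + τ`. The dead zone between `h` and `m` yields the lower bound on `t - h` where `H` is
  -- nonzero.
  set τ := (k - h) / 2 with hτ
  have hτ0 : 0 < τ := by rw [hτ]; linarith
  set m := (h + k) / 2 with hm
  have hm0 : 0 ≤ m := by rw [hm]; linarith
  have hd : ∀ t, HasDerivAt (fun t => τ * R ((t - m) / τ)) (deriv R ((t - m) / τ)) t := by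
    intro t
    have h1 : HasDerivAt (fun t => (t - m) / τ) (1 / τ) t := ((hasDerivAt_id t).sub_const m).div_const τ
    have h2 := ((hR.differentiable (by simp) ((t - m) / τ)).hasDerivAt.comp t h1).const_mul τ
    rwa [mul_comm (deriv R _), ← mul_assoc, mul_one_div_cancel hτ0.ne', one_mul] at h2
  have hderiv : ∀ t, deriv (fun t => τ * R ((t - m) / τ)) t = deriv R ((t - m) / τ) := fun t =>
    (hd t).deriv
  refine ⟨fun t => τ * R ((t - m) / τ), ?_, ?_, fun t => mul_nonneg hτ0.le (hR0 _), fun t => ?_,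
    fun t => ?_, fun t => max_le ?_ (mul_nonneg hτ0.le (hR0 _)), fun t ht => ?_⟩
  · exact contDiff_const.mul (hR.comp ((contDiff_id.sub contDiff_const).div_const τ))
  · simp only
    rw [hRneg _ (div_nonpos_of_nonpos_of_nonneg (by linarith) hτ0.le), mul_zero]
  · rw [hderiv]; exact hR' _
  · rw [hderiv]
    have h1 := mul_le_mul_of_nonneg_left (hRt ((t - m) / τ)) hτ0.le
    refine h1.trans ?_
    rw [← mul_assoc, mul_div_cancel₀ _ hτ0.ne']
    refine mul_le_mul_of_nonneg_right (le_trans ?_ (le_max_left _ _)) (hR' _).1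
    rw [hm]; linarith
  · have h1 := mul_le_mul_of_nonneg_left (hR1 ((t - m) / τ)) hτ0.le
    refine le_trans (le_of_eq ?_) h1
    field_simp
    rw [hτ, hm]; ring
  · by_contra hlt
    refine ht ?_
    simp only
    rw [hRneg _ (div_nonpos_of_nonpos_of_nonneg ?_ hτ0.le), mul_zero]
    rw [hm]; linarith

theorem exists_bound_deriv_smoothTransition :
    ∃ C : ℝ, 0 < C ∧ ∀ t, |deriv Real.smoothTransition t| ≤ C := by
  have hc : Continuous (deriv Real.smoothTransition) :=
    (Real.smoothTransition.contDiff (n := 1)).continuous_deriv (by simp)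
  have hs : HasCompactSupport (deriv Real.smoothTransition) := by
    refine HasCompactSupport.intro (isCompact_Icc (a := (0 : ℝ)) (b := 1)) fun t ht => ?_
    rw [Set.mem_Icc, not_and_or, not_le, not_le] at ht
    rcases ht with ht | ht
    · have : Real.smoothTransition =ᶠ[𝓝 t] fun _ => 0 := by
        filter_upwards [gt_mem_nhds ht] with s hs using
          Real.smoothTransition.zero_of_nonpos (le_of_lt hs)
      rw [this.deriv_eq, deriv_const]
    · have : Real.smoothTransition =ᶠ[𝓝 t] fun _ => 1 := by
        filter_upwards [lt_mem_nhds ht] with s hs using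
          Real.smoothTransition.one_of_one_le (le_of_lt hs)
      rw [this.deriv_eq, deriv_const]
  obtain ⟨C, hC⟩ := hc.bounded_above_of_compact_support hs
  exact ⟨max C 1, by positivity, fun t => (hC t).trans (le_max_left _ _)⟩

/-- Radial cutoff functions between two concentric balls. -/
theorem exists_cutoff (n : ℕ) : ∃ c : ℝ, 0 < c ∧ ∀ N ρ R : ℝ, 0 < N → 1 / 2 ≤ ρ → ρ + 1 / N ≤ R →
    R ≤ 1 → ∃ η : EuclideanSpace ℝ (Fin n) → ℝ, IsTestFunction (Metric.ball 0 1) η ∧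
      (∀ x, 0 ≤ η x ∧ η x ≤ 1) ∧ (∀ x ∈ Metric.ball 0 ρ, η x = 1) ∧
      (∀ x ∉ Metric.ball 0 R, η x = 0 ∧ gradient η x = 0) ∧ ∀ x, ‖gradient η x‖ ≤ c * N := by
  obtain ⟨C, hC0, hC⟩ := exists_bound_deriv_smoothTransition
  refine ⟨4 * C, by positivity, fun N ρ R hN hρ hρR hR => ?_⟩
  have hN' : 0 < 1 / N := by positivity
  set b := (ρ + R) / 2 with hb
  have hρb : ρ + 1 / (2 * N) ≤ b := by
    have : 1 / (2 * N) = 1 / N / 2 := by field_simp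
    rw [this, hb]; linarith
  have hN2 : 0 < 1 / (2 * N) := by positivity
  have hbR : b < R := by rw [hb]; linarith
  have hb0 : 0 < b := by linarith
  -- The cutoff is a function of `‖x‖²` to be smooth at the origin. Since `ρ ≥ 1/2`, one has `b + ρ
  -- ≥ 1`, so passing to squares does not shrink the gap.
  have hgap : 1 / (2 * N) ≤ b ^ 2 - ρ ^ 2 := by nlinarith
  set κ := 1 / (b ^ 2 - ρ ^ 2) with hκ
  have hgap0 : 0 < b ^ 2 - ρ ^ 2 := lt_of_lt_of_le hN2 hgap
  have hκ0 : 0 < κ := by positivity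
  have hκN : κ ≤ 2 * N := by
    rw [hκ, div_le_iff₀ hgap0]
    rw [div_le_iff₀ (by positivity)] at hgap
    linarith
  set η : EuclideanSpace ℝ (Fin n) → ℝ := fun x =>
    Real.smoothTransition ((b ^ 2 - ‖x‖ ^ 2) * κ) with hη
  have hsupp : tsupport η ⊆ Metric.closedBall 0 b := by
    refine closure_minimal (fun x hx => ?_) Metric.isClosed_closedBall
    rw [mem_closedBall_zero_iff]
    by_contra hlt
    push Not at hlt
    refine hx (Real.smoothTransition.zero_of_nonpos (mul_nonpos_of_nonpos_of_nonneg ?_ hκ0.le))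
    nlinarith
  have hηs : ContDiff ℝ ∞ η := Real.smoothTransition.contDiff.comp
    ((contDiff_const.sub (contDiff_norm_sq ℝ)).mul contDiff_const)
  have hout : ∀ x ∉ Metric.ball 0 R, x ∉ tsupport η := fun x hx hxt => by
    have := hsupp hxt
    rw [mem_closedBall_zero_iff] at this
    rw [mem_ball_zero_iff] at hx
    linarith
  refine ⟨η, ⟨hηs, ?_, ?_⟩, fun x => ⟨Real.smoothTransition.nonneg _, Real.smoothTransition.le_one _⟩,
    fun x hx => ?_, fun x hx => ⟨image_eq_zero_of_notMem_tsupport (hout x hx),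
      gradient_eq_zero_of_notMem_tsupport (hout x hx)⟩, fun x => ?_⟩
  · exact (isCompact_closedBall 0 b).of_isClosed_subset (isClosed_tsupport _) hsupp
  · exact hsupp.trans (Metric.closedBall_subset_ball (by linarith))
  · refine Real.smoothTransition.one_of_one_le ?_
    rw [mem_ball_zero_iff] at hx
    rw [hκ, mul_one_div, le_div_iff₀ hgap0]
    nlinarith [norm_nonneg x]
  · by_cases hx : x ∈ Metric.ball 0 R
    · have hx1 : ‖x‖ ≤ 1 := by
        rw [mem_ball_zero_iff] at hx; linarith
      have h1 : HasFDerivAt (fun x : EuclideanSpace ℝ (Fin n) => (b ^ 2 - ‖x‖ ^ 2) * κ)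
          (κ • (-((2 : ℕ) • (innerSL ℝ x : EuclideanSpace ℝ (Fin n) →L[ℝ] ℝ)))) x := by
        have := ((hasStrictFDerivAt_norm_sq x).hasFDerivAt.const_sub (b ^ 2)).mul_const κ
        exact this
      have h2 := ((Real.smoothTransition.contDiff (n := 1)).differentiable (by simp)
        ((b ^ 2 - ‖x‖ ^ 2) * κ)).hasDerivAt.comp_hasFDerivAt x h1
      have h3 : fderiv ℝ η x = _ := h2.fderiv
      rw [gradient, LinearIsometryEquiv.norm_map, h3, norm_smul, norm_smul, norm_neg]
      have h4 : ‖(2 : ℕ) • innerSL ℝ x‖ ≤ 2 := by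
        rw [two_nsmul]
        refine (norm_add_le _ _).trans ?_
        rw [innerSL_apply_norm]; linarith
      calc _ ≤ C * (2 * N * 2) := by
            refine mul_le_mul (hC _) (mul_le_mul ?_ h4 (norm_nonneg _) (by positivity))
              (by positivity) hC0.le
            rw [Real.norm_of_nonneg hκ0.le]; exact hκN
        _ = 4 * C * N := by ring
    · rw [gradient_eq_zero_of_notMem_tsupport (hout x hx), norm_zero]
      positivity

end Cutoff

/-! ### Arithmetic of the exponents -/

section Exponents

theorem ENNReal.inv_coe_toNNReal_inv {a : ℝ} (ha : 0 < a) :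
    ((Real.toNNReal a⁻¹ : NNReal) : ℝ≥0∞)⁻¹ = ENNReal.ofReal a := by
  rw [← ENNReal.ofReal, ← ENNReal.ofReal_inv_of_pos (by positivity), inv_inv]

/-- The exponents of the iteration: `σ` is the exponent of the Caccioppoli inequality, `τ` the one
gained by the Sobolev inequality. -/
theorem exists_exponents {n : ℕ} (hn : 2 ≤ n) {p q : ℝ≥0∞} (hp : p ≠ ⊤)
    (hpq : (n : ℝ≥0∞) / p + 1 / q < 2 / (n : ℝ≥0∞)) :
    1 ≤ p ∧ 1 ≤ p / ((n : ℝ≥0∞) - 1) ∧ p / ((n : ℝ≥0∞) - 1) ≠ ⊤ ∧ ∃ σ τ r r' : NNReal,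
      1 ≤ σ ∧ σ < τ ∧ 1 ≤ r ∧ (r : ℝ≥0∞) ≤ p ∧ 1 ≤ r' ∧ (r' : ℝ≥0∞) ≤ p ∧
      (τ : ℝ)⁻¹ = (r : ℝ)⁻¹ - (n : ℝ)⁻¹ ∧ (σ : ℝ)⁻¹ = (r' : ℝ)⁻¹ - (n : ℝ)⁻¹ ∧
      (σ : ℝ≥0∞)⁻¹ + ((σ : ℝ≥0∞)⁻¹ + (p / ((n : ℝ≥0∞) - 1))⁻¹) = 1 ∧
      p⁻¹ / 2 + (q⁻¹ / 2 + 2⁻¹) = (r : ℝ≥0∞)⁻¹ := by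
  have hn0 : (n : ℝ≥0∞) ≠ 0 := by simp; omega
  have hR2 : (2 : ℝ) ≤ n := by exact_mod_cast hn
  have hlt : (2 : ℝ≥0∞) / n ≠ ⊤ := ENNReal.div_ne_top (by simp) hn0
  have h1t : (n : ℝ≥0∞) / p ≠ ⊤ := (lt_of_le_of_lt le_self_add hpq).ne_top
  have h2t : 1 / q ≠ ⊤ := (lt_of_le_of_lt le_add_self hpq).ne_top
  have hp0 : p ≠ 0 := by
    rintro rfl
    exact h1t (ENNReal.div_zero hn0)
  -- In the reciprocals `x = 1/p` and `y = 1/q` everything is affine: `1/σ = (1 - (n-1)x)/2`, `1/r =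
  -- (1 + x + y)/2`, `1/τ = 1/r - 1/n` and `1/r' = 1/σ + 1/n`.
  set x := p.toReal⁻¹ with hx
  set y := (q⁻¹).toReal with hy
  have hP : 0 < p.toReal := ENNReal.toReal_pos hp0 hp
  have hx0 : 0 < x := inv_pos.2 hP
  have hy0 : 0 ≤ y := ENNReal.toReal_nonneg
  have hpx : p⁻¹ = ENNReal.ofReal x := by
    rw [hx, ENNReal.ofReal_inv_of_pos hP, ENNReal.ofReal_toReal hp]
  have hqy : q⁻¹ = ENNReal.ofReal y := by
    rw [hy, ENNReal.ofReal_toReal]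
    simpa using h2t
  have hxy : n * x + y < 2 / n := by
    have h := (ENNReal.toReal_lt_toReal (ENNReal.add_ne_top.2 ⟨h1t, h2t⟩) hlt).2 hpq
    rw [ENNReal.toReal_add h1t h2t, ENNReal.toReal_div, one_div] at h
    simpa [hx, hy, div_eq_mul_inv] using h
  have hn1 : (n : ℝ≥0∞) - 1 = ENNReal.ofReal ((n : ℝ) - 1) := by
    rw [ENNReal.ofReal_sub _ zero_le_one]; simp
  have hn1' : (0 : ℝ) < n - 1 := by linarith
  have hs : (p / ((n : ℝ≥0∞) - 1))⁻¹ = ENNReal.ofReal ((n - 1) * x) := by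
    rw [ENNReal.inv_div (Or.inr hp) (Or.inr hp0), hn1, div_eq_mul_inv, hpx,
      ENNReal.ofReal_mul hn1'.le]
  have hn2 : (2 : ℝ) / n ≤ 1 := by rw [div_le_one (by linarith)]; exact hR2
  have hnx : n * x < 1 := by linarith
  have hxn : x ≤ n * x := by nlinarith
  have hni : (0 : ℝ) < (n : ℝ)⁻¹ := by positivity
  have hni2 : (n : ℝ)⁻¹ ≤ 1 / 2 := by
    rw [inv_le_comm₀ (by linarith) (by norm_num)]; simpa using hR2
  have h2n : (2 : ℝ) / n = 2 * (n : ℝ)⁻¹ := div_eq_mul_inv _ _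
  rw [h2n] at hxy
  have hnn : (n : ℝ) * (n : ℝ)⁻¹ = 1 := mul_inv_cancel₀ (by linarith)
  have hA : 0 < (1 - (n - 1) * x) / 2 := by nlinarith
  have hBr : 0 < (1 + x + y) / 2 := by linarith
  have hC : 0 < (1 + x + y) / 2 - (n : ℝ)⁻¹ := by linarith
  have hD : 0 < (1 - (n - 1) * x) / 2 + (n : ℝ)⁻¹ := by linarith
  have hle : ∀ {a : ℝ}, 0 < a → a ≤ 1 → (1 : NNReal) ≤ Real.toNNReal a⁻¹ := fun ha h1 => by
    rw [Real.one_le_toNNReal]; exact (one_le_inv₀ ha).2 h1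
  have hlep : ∀ {a : ℝ}, 0 < a → x ≤ a → ((Real.toNNReal a⁻¹ : NNReal) : ℝ≥0∞) ≤ p := by
    intro a ha h
    rw [← ENNReal.inv_le_inv, ENNReal.inv_coe_toNNReal_inv ha, hpx]
    exact ENNReal.ofReal_le_ofReal h
  refine ⟨?_, ?_, ENNReal.div_ne_top hp ?_, Real.toNNReal ((1 - (n - 1) * x) / 2)⁻¹,
    Real.toNNReal ((1 + x + y) / 2 - (n : ℝ)⁻¹)⁻¹, Real.toNNReal ((1 + x + y) / 2)⁻¹,
    Real.toNNReal ((1 - (n - 1) * x) / 2 + (n : ℝ)⁻¹)⁻¹, hle hA ?_, ?_,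
    hle hBr ?_, hlep hBr ?_, hle hD ?_, hlep hD ?_, ?_, ?_, ?_, ?_⟩
  · rw [← ENNReal.inv_le_inv, hpx, inv_one]
    exact ENNReal.ofReal_le_one.2 (by linarith)
  · rw [← ENNReal.inv_le_inv, hs, inv_one]
    exact ENNReal.ofReal_le_one.2 (by linarith)
  · rw [hn1]; simpa using hn1'
  · nlinarith
  -- The inequality `1/τ < 1/σ` is the hypothesis `n x + y < 2/n` rearranged.
  · rw [Real.toNNReal_lt_toNNReal_iff (by positivity)]
    refine (inv_lt_inv₀ hA hC).2 ?_
    linarith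
  · linarith
  · linarith
  · nlinarith
  -- The bound `x < 2/n²` gives `r' ≤ p`, so that `u` itself lies in `L^σ` locally.
  · have : (n * x) * (n : ℝ)⁻¹ < (2 * (n : ℝ)⁻¹) * (n : ℝ)⁻¹ := by
      refine mul_lt_mul_of_pos_right (by linarith) hni
    have h3 : x < 2 * (n : ℝ)⁻¹ * (n : ℝ)⁻¹ := by
      calc x = (n * x) * (n : ℝ)⁻¹ := by rw [mul_comm (n : ℝ) x, mul_assoc, hnn, mul_one]
        _ < _ := this
    nlinarith
  · rw [Real.coe_toNNReal _ (by positivity), Real.coe_toNNReal _ (by positivity), inv_inv, inv_inv]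
  · rw [Real.coe_toNNReal _ (by positivity), Real.coe_toNNReal _ (by positivity), inv_inv, inv_inv]
    ring
  · rw [ENNReal.inv_coe_toNNReal_inv hA, hs, ← ENNReal.ofReal_add hA.le (by positivity),
      ← ENNReal.ofReal_add hA.le (by positivity), ← ENNReal.ofReal_one]
    congr 1; ring
  · have h2 : (2 : ℝ≥0∞) = ENNReal.ofReal 2 := by simp
    rw [ENNReal.inv_coe_toNNReal_inv hBr, hpx, hqy, h2, ← ENNReal.ofReal_div_of_pos (by norm_num),
      ← ENNReal.ofReal_div_of_pos (by norm_num), ← ENNReal.ofReal_inv_of_pos (by norm_num),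
      ← ENNReal.ofReal_add (by positivity) (by positivity),
      ← ENNReal.ofReal_add (by positivity) (by positivity)]
    congr 1; ring

end Exponents

/-! ### Caccioppoli inequality -/

section Caccioppoli

open Filter Topology

variable {n : ℕ}

/-- The bilinear form of a matrix. -/
def Matrix.bilin (A : Matrix (Fin n) (Fin n) ℝ) (ξ ζ : EuclideanSpace ℝ (Fin n)) : ℝ :=
  ∑ i, ∑ j, A i j * ξ i * ζ j

theorem Matrix.bilin_combo_right (A : Matrix (Fin n) (Fin n) ℝ)
    (ξ ζ ζ' : EuclideanSpace ℝ (Fin n)) (s t : ℝ) :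
    A.bilin ξ (s • ζ + t • ζ') = s * A.bilin ξ ζ + t * A.bilin ξ ζ' := by
  simp only [Matrix.bilin, Finset.mul_sum, ← Finset.sum_add_distrib, PiLp.add_apply,
    PiLp.smul_apply, smul_eq_mul]
  exact Finset.sum_congr rfl fun i _ => Finset.sum_congr rfl fun j _ => by ring

theorem Matrix.bilin_comm {A : Matrix (Fin n) (Fin n) ℝ} (hA : A.IsSymm)
    (ξ ζ : EuclideanSpace ℝ (Fin n)) : A.bilin ξ ζ = A.bilin ζ ξ := by
  rw [Matrix.bilin, Finset.sum_comm]
  refine Finset.sum_congr rfl fun i _ => Finset.sum_congr rfl fun j _ => ?_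
  rw [hA.apply]; ring

theorem Matrix.bilin_combo {A : Matrix (Fin n) (Fin n) ℝ} (hA : A.IsSymm)
    (ξ ζ : EuclideanSpace ℝ (Fin n)) (s t : ℝ) :
    A.bilin (s • ξ + t • ζ) (s • ξ + t • ζ) =
      s ^ 2 * A.bilin ξ ξ + 2 * s * t * A.bilin ξ ζ + t ^ 2 * A.bilin ζ ζ := by
  rw [A.bilin_combo_right, A.bilin_comm hA _ ξ, A.bilin_comm hA _ ζ, A.bilin_combo_right,
    A.bilin_combo_right, A.bilin_comm hA ζ ξ]
  ring

/-- The form is nonnegative at both `s ξ + t ζ` and `s ξ - t ζ`; expanding gives the two sides of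
the absolute value. -/
theorem Matrix.abs_bilin_le {A : Matrix (Fin n) (Fin n) ℝ} (hA : A.IsSymm)
    (hpos : ∀ ξ, 0 ≤ A.bilin ξ ξ) (ξ ζ : EuclideanSpace ℝ (Fin n)) (s t : ℝ) :
    |2 * s * t * A.bilin ξ ζ| ≤ s ^ 2 * A.bilin ξ ξ + t ^ 2 * A.bilin ζ ζ := by
  have h1 := hpos (s • ξ + t • ζ)
  have h2 := hpos (s • ξ + (-t) • ζ)
  rw [Matrix.bilin_combo hA] at h1 h2
  rw [abs_le]
  constructor <;> nlinarith

/-- Here `P` is the energy to be bounded, `X` the tested form and `R` the error. Integrability of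
`R` need not be known: if its integral is infinite there is nothing to prove, otherwise the
integrals split. -/
theorem lintegral_ofReal_le_of_integral_le {α : Type*} [MeasurableSpace α] {μ : Measure α}
    {P R X F : α → ℝ} (hR : AEStronglyMeasurable R μ) (hR0 : ∀ᵐ x ∂μ, 0 ≤ R x)
    (hP0 : ∀ᵐ x ∂μ, 0 ≤ P x) (hPX : ∀ᵐ x ∂μ, P x ≤ X x + R x) (hX : Integrable X μ)
    (hF : Integrable F μ) (hXF : ∫ x, X x ∂μ ≤ ∫ x, F x ∂μ) :
    ∫⁻ x, ENNReal.ofReal (P x) ∂μ ≤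
      ∫⁻ x, ENNReal.ofReal (R x) ∂μ + ∫⁻ x, ENNReal.ofReal |F x| ∂μ := by
  by_cases hRt : ∫⁻ x, ENNReal.ofReal (R x) ∂μ = ⊤
  · simp [hRt]
  have hRi : Integrable R μ := ⟨hR, by
    rw [hasFiniteIntegral_iff_ofReal hR0]; exact lt_top_iff_ne_top.2 hRt⟩
  calc ∫⁻ x, ENNReal.ofReal (P x) ∂μ ≤ ∫⁻ x, ENNReal.ofReal (X x + R x) ∂μ :=
        lintegral_mono_ae (hPX.mono fun x hx => ENNReal.ofReal_le_ofReal hx)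
    _ = ENNReal.ofReal (∫ x, (X x + R x) ∂μ) :=
        (ofReal_integral_eq_lintegral_ofReal (hX.add hRi) (by
          filter_upwards [hP0, hPX] with x h1 h2 using h1.trans h2)).symm
    _ ≤ ENNReal.ofReal ((∫ x, R x ∂μ) + ∫ x, |F x| ∂μ) := by
        refine ENNReal.ofReal_le_ofReal ?_
        rw [integral_add hX hRi]
        have : ∫ x, F x ∂μ ≤ ∫ x, |F x| ∂μ :=
          integral_mono hF hF.abs fun x => le_abs_self _
        linarith
    _ ≤ _ := by
        refine ENNReal.ofReal_add_le.trans_eq ?_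
        rw [ofReal_integral_eq_lintegral_ofReal hRi hR0,
          ofReal_integral_eq_lintegral_ofReal hF.abs (Eventually.of_forall fun x => abs_nonneg _)]

theorem IsTestFunction.gradient_mul_self {Ω : Set (EuclideanSpace ℝ (Fin n))}
    {η : EuclideanSpace ℝ (Fin n) → ℝ} (hη : IsTestFunction Ω η) (x : EuclideanSpace ℝ (Fin n)) :
    gradient (fun x => η x * η x) x = (2 * η x) • gradient η x := by
  have h := (hη.hasGradientAt_mul_comp (G := id) contDiff_id (hη.hasGradientAt x)).gradient
  simp only [id, deriv_id] at h
  rw [h]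
  module

/-- The Caccioppoli inequality for a truncation `H` of a subsolution. -/
theorem caccioppoli {Ω : Set (EuclideanSpace ℝ (Fin n))} (hΩ : IsOpen Ω) {p : ℝ≥0∞} (hp1 : 1 ≤ p)
    (hp : p ≠ ⊤) {a : EuclideanSpace ℝ (Fin n) → Matrix (Fin n) (Fin n) ℝ}
    {lam d c f u : EuclideanSpace ℝ (Fin n) → ℝ}
    {Du : EuclideanSpace ℝ (Fin n) → EuclideanSpace ℝ (Fin n)}
    (ha : DegenerateElliptic Ω a lam d)
    (hlam : AEStronglyMeasurable lam (volume.restrict Ω))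
    (hc : AEStronglyMeasurable c (volume.restrict Ω))
    (hu : HasSobolevGradient Ω p u Du)
    (hsub : ∀ φ Dφ, HasSobolevGradientZero Ω p φ Dφ → (∀ᵐ x ∂(volume.restrict Ω), 0 ≤ φ x) →
      IntegrableOn (fun x => (∑ i, ∑ j, a x i j * Du x i * Dφ x j) + c x * u x * φ x) Ω ∧
      IntegrableOn (fun x => f x * φ x) Ω ∧
      ∫ x in Ω, ((∑ i, ∑ j, a x i j * Du x i * Dφ x j) + c x * u x * φ x) ≤ ∫ x in Ω, f x * φ x)
    {η : EuclideanSpace ℝ (Fin n) → ℝ} (hη : IsTestFunction Ω η)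
    {H : ℝ → ℝ} {h : ℝ} (hH : ContDiff ℝ ∞ H) (hH0 : H 0 = 0) (hHn : ∀ t, 0 ≤ H t)
    (hH' : ∀ t, 0 ≤ deriv H t ∧ deriv H t ≤ 1) (hHc : ∀ t, H t ≤ max (t - h) 0 * deriv H t) :
    ∫⁻ x in Ω, ENNReal.ofReal (η x ^ 2 * deriv H (u x) * (d x / lam x * ‖Du x‖ ^ 2) / 2) ≤
      (∫⁻ x in Ω, ENNReal.ofReal (2 * max (u x - h) 0 ^ 2 * (lam x ^ (n - 1) * ‖gradient η x‖ ^ 2) +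
        |c x| * |u x| * (η x ^ 2 * H (u x)))) +
      ∫⁻ x in Ω, ENNReal.ofReal |f x * (η x * η x * H (u x))| := by
  have hη2 : IsTestFunction Ω (fun x => η x * η x) := hη.mul_of_contDiff hη.smooth
  have hφ := hu.mul_comp hΩ hp1 hp hη2 hH hH0 (B := 1) fun t => by
    rw [abs_of_nonneg (hH' t).1]; exact (hH' t).2
  obtain ⟨hX, hF, hXF⟩ := hsub _ _ hφ (Eventually.of_forall fun x =>
    mul_nonneg (mul_self_nonneg _) (hHn _))
  have hum := hu.memLp.1
  refine lintegral_ofReal_le_of_integral_le ?_ ?_ ?_ ?_ hX hF hXF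
  · have hw : AEStronglyMeasurable (fun x => max (u x - h) 0) (volume.restrict Ω) :=
      (continuous_id.sub continuous_const).max continuous_const |>.comp_aestronglyMeasurable hum
    have hg : AEStronglyMeasurable (fun x => ‖gradient η x‖ ^ 2) (volume.restrict Ω) :=
      (hη.continuous_gradient.norm.pow 2).aestronglyMeasurable
    refine AEStronglyMeasurable.add ?_ ?_
    · exact ((hw.pow 2).const_mul 2).mul ((hlam.pow _).mul hg)
    · exact (hc.norm.mul hum.norm).mul ((hη.smooth.continuous.pow 2).aestronglyMeasurable.mul
        (hH.continuous.comp_aestronglyMeasurable hum))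
  · filter_upwards [ha.lam_pos] with x hx
    have := hHn (u x)
    positivity
  · filter_upwards [ha.lam_pos, ha.d_pos] with x hx hx'
    have := (hH' (u x)).1
    positivity
  · filter_upwards [ha.lam_pos, ha.d_pos, ha.symm, ha.lower, ha.upper] with x hlx hdx hs hl hup
    have hpos : ∀ ξ, 0 ≤ (a x).bilin ξ ξ := fun ξ => (by positivity : 0 ≤ d x / lam x * ‖ξ‖ ^ 2).trans
      (hl ξ)
    have hQ : d x / lam x * ‖Du x‖ ^ 2 ≤ (a x).bilin (Du x) (Du x) := hl _
    have hQ' : (a x).bilin (gradient η x) (gradient η x) ≤ lam x ^ (n - 1) * ‖gradient η x‖ ^ 2 :=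
      hup _
    have hsum : ∑ i, ∑ j, a x i j * Du x i *
        ((η x * η x * deriv H (u x)) • Du x + H (u x) • gradient (fun x => η x * η x) x) j =
        η x * η x * deriv H (u x) * (a x).bilin (Du x) (Du x) +
          (H (u x) * (2 * η x)) * (a x).bilin (Du x) (gradient η x) := by
      rw [hη.gradient_mul_self, smul_smul, ← Matrix.bilin_combo_right]
      rfl
    rw [hsum]
    set w := max (u x - h) 0 with hw
    set D := deriv H (u x) with hD
    have hD0 : 0 ≤ D := (hH' _).1
    have hD1 : D ≤ 1 := (hH' _).2
    have hw0 : 0 ≤ w := le_max_right _ _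
    set Q := (a x).bilin (Du x) (Du x)
    set Q' := (a x).bilin (gradient η x) (gradient η x)
    set b := (a x).bilin (Du x) (gradient η x)
    have hb : |2 * η x * (2 * w) * b| ≤ η x ^ 2 * Q + (2 * w) ^ 2 * Q' :=
      Matrix.abs_bilin_le hs hpos _ _ _ _
    -- By `H ≤ w H'` the cross term carries the factor `H'`. The weights `η` and `2 w` make it cost
    -- exactly half of the principal term and leave `2 w² H'` times the form at the gradient of `η`.
    have hcross : |H (u x) * (2 * η x) * b| ≤ D / 2 * (η x ^ 2 * Q + (2 * w) ^ 2 * Q') := by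
      have h1 : |H (u x) * (2 * η x) * b| ≤ w * D * |2 * η x * b| := by
        rw [mul_assoc, abs_mul, abs_of_nonneg (hHn _)]
        exact mul_le_mul_of_nonneg_right (hHc _) (abs_nonneg _)
      have h2 : w * D * |2 * η x * b| = D / 2 * |2 * η x * (2 * w) * b| := by
        rw [show 2 * η x * (2 * w) * b = (2 * w) * (2 * η x * b) by ring, abs_mul (2 * w),
          abs_of_nonneg (by positivity : 0 ≤ 2 * w)]
        ring
      rw [h2] at h1
      exact h1.trans (mul_le_mul_of_nonneg_left hb (by positivity))
    have hcu : -(|c x| * |u x| * (η x ^ 2 * H (u x))) ≤ c x * u x * (η x * η x * H (u x)) := by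
      have h1 : -(|c x| * |u x|) ≤ c x * u x := by
        rw [← abs_mul]; exact neg_abs_le _
      have h2 : 0 ≤ η x ^ 2 * H (u x) := mul_nonneg (sq_nonneg _) (hHn _)
      have h3 := mul_le_mul_of_nonneg_right h1 h2
      calc _ = -(|c x| * |u x|) * (η x ^ 2 * H (u x)) := by ring
        _ ≤ _ := h3
        _ = _ := by ring
    have h4 : η x ^ 2 * D * (d x / lam x * ‖Du x‖ ^ 2) ≤ η x ^ 2 * D * Q := by gcongr
    have h5 : D * (w ^ 2 * Q') ≤ w ^ 2 * (lam x ^ (n - 1) * ‖gradient η x‖ ^ 2) := by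
      calc D * (w ^ 2 * Q') ≤ 1 * (w ^ 2 * Q') := by
            refine mul_le_mul_of_nonneg_right hD1 (mul_nonneg (sq_nonneg _) (hpos _))
        _ ≤ _ := by rw [one_mul]; gcongr
    have h6 := (abs_le.1 hcross).1
    nlinarith

end Caccioppoli

/-! ### Hölder inequalities with weights -/

section Holder

open Filter Topology

theorem lintegral_enorm_mul_mul_le {α : Type*} [MeasurableSpace α] {μ : Measure α} {w Z : α → ℝ}
    {σ s : ℝ≥0∞} (hσ : σ⁻¹ + (σ⁻¹ + s⁻¹) = 1) (hw : AEStronglyMeasurable w μ)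
    (hZ : AEStronglyMeasurable Z μ) :
    ∫⁻ x, ‖w x * (w x * Z x)‖ₑ ∂μ ≤ eLpNorm w σ μ * (eLpNorm w σ μ * eLpNorm Z s μ) := by
  have h1 : ENNReal.HolderTriple σ s (σ⁻¹ + s⁻¹)⁻¹ := ⟨(inv_inv _).symm⟩
  have h2 : ENNReal.HolderTriple σ (σ⁻¹ + s⁻¹)⁻¹ 1 := ⟨by rw [inv_inv, hσ, inv_one]⟩
  have e1 : eLpNorm (fun x => w x * Z x) (σ⁻¹ + s⁻¹)⁻¹ μ ≤ eLpNorm w σ μ * eLpNorm Z s μ :=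
    eLpNorm_smul_le_mul_eLpNorm (𝕜 := ℝ) hZ hw
  have e2 : eLpNorm (fun x => w x * (w x * Z x)) 1 μ ≤
      eLpNorm w σ μ * eLpNorm (fun x => w x * Z x) (σ⁻¹ + s⁻¹)⁻¹ μ :=
    eLpNorm_smul_le_mul_eLpNorm (𝕜 := ℝ) (hw.mul hZ) hw
  rw [eLpNorm_one_eq_lintegral_enorm] at e2
  exact e2.trans (by gcongr)

theorem eLpNorm_rpow_half {α : Type*} [MeasurableSpace α] {μ : Measure α} (f : α → ℝ) (p : ℝ≥0∞) :
    eLpNorm (fun x => ‖f x‖ ^ (1 / 2 : ℝ)) (p * 2) μ = eLpNorm f p μ ^ (1 / 2 : ℝ) := by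
  rw [eLpNorm_norm_rpow f (by norm_num), mul_assoc]
  congr 2
  have : (2 : ℝ≥0∞) * ENNReal.ofReal (1 / 2) = 1 := by
    rw [show (2 : ℝ≥0∞) = ENNReal.ofReal 2 by simp, ← ENNReal.ofReal_mul (by norm_num)]
    norm_num
  rw [this, mul_one]

/-- Hölder's inequality against the degenerate weight `d / lam`. -/
theorem eLpNorm_le_of_weight {α F : Type*} [MeasurableSpace α] [NormedAddCommGroup F]
    [NormedSpace ℝ F] {μ : Measure α} {p q r : ℝ≥0∞} (hr : p⁻¹ / 2 + (q⁻¹ / 2 + 2⁻¹) = r⁻¹)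
    {lam d : α → ℝ} {W : α → F} (hlam : AEStronglyMeasurable lam μ)
    (hd : AEStronglyMeasurable (fun x => (d x)⁻¹) μ) (hW : AEStronglyMeasurable W μ)
    (hlam0 : ∀ᵐ x ∂μ, 0 < lam x) (hd0 : ∀ᵐ x ∂μ, 0 < d x) :
    eLpNorm W r μ ≤ eLpNorm lam p μ ^ (1 / 2 : ℝ) * (eLpNorm (fun x => (d x)⁻¹) q μ ^ (1 / 2 : ℝ) *
      (∫⁻ x, ENNReal.ofReal (d x / lam x * ‖W x‖ ^ 2) ∂μ) ^ (1 / 2 : ℝ)) := by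
  set A : α → ℝ := fun x => ‖lam x‖ ^ (1 / 2 : ℝ) with hA
  set B : α → ℝ := fun x => ‖(d x)⁻¹‖ ^ (1 / 2 : ℝ) with hB
  -- `W` factors as `λ^(1/2) d^(-1/2) Y` with `‖Y‖² = (d/λ) ‖W‖²`; the factors lie in `L^(2p)`,
  -- `L^(2q)` and `L²`.
  set Y : α → F := fun x => ((A x)⁻¹ * (B x)⁻¹) • W x with hY
  have hAm : AEStronglyMeasurable A μ :=
    (hlam.norm.aemeasurable.pow_const _).aestronglyMeasurable
  have hBm : AEStronglyMeasurable B μ :=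
    (hd.norm.aemeasurable.pow_const _).aestronglyMeasurable
  have hYm : AEStronglyMeasurable Y μ :=
    ((hAm.aemeasurable.inv).mul hBm.aemeasurable.inv).aestronglyMeasurable.smul hW
  have hWY : W =ᵐ[μ] A • (B • Y) := by
    filter_upwards [hlam0, hd0] with x hx hx'
    have hA0 : A x ≠ 0 := (Real.rpow_pos_of_pos (norm_pos_iff.2 hx.ne') _).ne'
    have hB0 : B x ≠ 0 := (Real.rpow_pos_of_pos (norm_pos_iff.2 (inv_ne_zero hx'.ne')) _).ne'
    simp only [Pi.smul_apply', hY, smul_smul]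
    rw [show A x * (B x * ((A x)⁻¹ * (B x)⁻¹)) = 1 by field_simp, one_smul]
  have hinv : ∀ t : ℝ≥0∞, (t * 2)⁻¹ = t⁻¹ / 2 := fun t => by
    rw [ENNReal.mul_inv (Or.inr (by simp)) (Or.inr (by simp)), div_eq_mul_inv]
  have h1 : ENNReal.HolderTriple (q * 2) 2 ((q * 2)⁻¹ + 2⁻¹)⁻¹ := ⟨(inv_inv _).symm⟩
  have h2 : ENNReal.HolderTriple (p * 2) ((q * 2)⁻¹ + 2⁻¹)⁻¹ r :=
    ⟨by rw [inv_inv, hinv, hinv, hr]⟩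
  rw [eLpNorm_congr_ae hWY]
  refine (eLpNorm_smul_le_mul_eLpNorm (𝕜 := ℝ) (p := p * 2) (q := ((q * 2)⁻¹ + 2⁻¹)⁻¹)
    (hBm.smul hYm) hAm).trans ?_
  rw [hA, eLpNorm_rpow_half]
  gcongr
  refine (eLpNorm_smul_le_mul_eLpNorm (𝕜 := ℝ) (p := q * 2) (q := 2) hYm hBm).trans ?_
  rw [hB, eLpNorm_rpow_half (fun x => (d x)⁻¹)]
  gcongr
  rw [eLpNorm_eq_lintegral_rpow_enorm_toReal (by simp) (by simp), ENNReal.toReal_ofNat]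
  refine le_of_eq ?_
  congr 1
  refine lintegral_congr_ae ?_
  filter_upwards [hlam0, hd0] with x hx hx'
  rw [← ofReal_norm, ENNReal.ofReal_rpow_of_nonneg (norm_nonneg _) (by norm_num)]
  congr 1
  have hA2 : A x ^ 2 = lam x := by
    simp only [hA]
    rw [← Real.rpow_natCast, ← Real.rpow_mul (norm_nonneg _)]
    norm_num [abs_of_pos hx]
  have hB2 : B x ^ 2 = (d x)⁻¹ := by
    simp only [hB]
    rw [← Real.rpow_natCast, ← Real.rpow_mul (norm_nonneg _)]
    norm_num [abs_of_pos hx']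
  rw [Real.rpow_two]
  simp only [hY]
  rw [norm_smul, mul_pow, Real.norm_eq_abs, sq_abs, mul_pow, inv_pow, inv_pow, hA2, hB2, inv_inv]
  ring

theorem ENNReal.rpow_le_one_add {x : ℝ≥0∞} {e : ℝ} (he0 : 0 ≤ e) (he1 : e ≤ 1) :
    x ^ e ≤ 1 + x := by
  rcases le_total x 1 with hx | hx
  · exact (ENNReal.rpow_le_one hx he0).trans le_self_add
  · calc x ^ e ≤ x ^ (1 : ℝ) := ENNReal.rpow_le_rpow_of_exponent_le hx he1
      _ = x := ENNReal.rpow_one x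
      _ ≤ 1 + x := le_add_self

/-- The factor does not involve the exponents, which keeps the final constant independent of `p₀`.
-/
theorem eLpNorm_le_eLpNorm_mul_one_add_measure {α : Type*} [MeasurableSpace α] {μ : Measure α}
    {f : α → ℝ} (hf : AEStronglyMeasurable f μ) {s t : ℝ≥0∞} (hs1 : 1 ≤ s) (hst : s ≤ t) :
    eLpNorm f s μ ≤ eLpNorm f t μ * (1 + μ Set.univ) := by
  refine (eLpNorm_le_eLpNorm_mul_rpow_measure_univ hst hf).trans ?_
  gcongr
  by_cases hs : s = ⊤
  · subst hs
    rw [top_le_iff.1 hst]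
    simp
  have hs1' : 1 ≤ s.toReal := by
    simpa using ENNReal.toReal_mono hs hs1
  refine ENNReal.rpow_le_one_add ?_ ?_
  · by_cases ht : t = ⊤
    · subst ht; simp
    · rw [sub_nonneg]
      exact one_div_le_one_div_of_le (by linarith) (ENNReal.toReal_mono ht hst)
  · have h1 : 1 / s.toReal ≤ 1 := by rw [div_le_one (by linarith)]; exact hs1'
    have h2 : 0 ≤ 1 / t.toReal := by positivity
    linarith

theorem eLpNorm_pow {α : Type*} [MeasurableSpace α] {μ : Measure α} (f : α → ℝ) (s : ℝ≥0∞)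
    {m : ℕ} (hm : 0 < m) : eLpNorm (fun x => f x ^ m) s μ = eLpNorm f (s * m) μ ^ m := by
  have h := eLpNorm_norm_rpow (p := s) (μ := μ) f (q := m) (by exact_mod_cast hm)
  rw [ENNReal.ofReal_natCast, ENNReal.rpow_natCast] at h
  rw [← h, ← eLpNorm_norm]
  simp only [Real.rpow_natCast, norm_pow]

theorem lintegral_le_of_le_indicator {α : Type*} [MeasurableSpace α] {μ : Measure α} {S T : Set α}
    (hS : MeasurableSet S) (hST : S ⊆ T) {f g : α → ℝ≥0∞}
    (h : ∀ᵐ x ∂(μ.restrict T), f x ≤ S.indicator g x) :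
    ∫⁻ x in T, f x ∂μ ≤ ∫⁻ x in S, g x ∂μ := by
  refine (lintegral_mono_ae h).trans ?_
  rw [lintegral_indicator hS, Measure.restrict_restrict hS, Set.inter_eq_left.2 hST]

end Holder

/-! ### Gain of integrability in one step -/

section Step

open Filter Topology

variable {n : ℕ}

/-- Both bounds are evaluated at one unit vector. This controls the weight on the part of the
gradient that falls on the cutoff. -/
theorem DegenerateElliptic.div_le {Ω : Set (EuclideanSpace ℝ (Fin n))} (hn : 0 < n)
    {a : EuclideanSpace ℝ (Fin n) → Matrix (Fin n) (Fin n) ℝ}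
    {lam d : EuclideanSpace ℝ (Fin n) → ℝ} (ha : DegenerateElliptic Ω a lam d) :
    ∀ᵐ x ∂(volume.restrict Ω), d x / lam x ≤ lam x ^ (n - 1) := by
  filter_upwards [ha.lower, ha.upper] with x h1 h2
  have := (h1 (EuclideanSpace.single ⟨0, hn⟩ 1)).trans (h2 _)
  simpa using this

theorem eLpNorm_pow_sub_one {α : Type*} [MeasurableSpace α] {μ : Measure α} (hn : 2 ≤ n)
    (f : α → ℝ) (p : ℝ≥0∞) : eLpNorm (fun x => f x ^ (n - 1)) (p / ((n : ℝ≥0∞) - 1)) μ =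
      eLpNorm f p μ ^ (n - 1) := by
  rw [eLpNorm_pow _ _ (by omega)]
  have h1 : ((n : ℝ≥0∞) - 1) = ((n - 1 : ℕ) : ℝ≥0∞) := by simp
  rw [h1, ENNReal.div_mul_cancel (Nat.cast_ne_zero.2 (by omega)) (ENNReal.natCast_ne_top _)]

set_option maxHeartbeats 1000000 in
/-- One step of the iteration: the Caccioppoli inequality combined with the Sobolev inequality. -/
theorem exists_step_constant (hn : 2 ≤ n) {p q : ℝ≥0∞} (hp : p ≠ ⊤) (hp1 : 1 ≤ p)
    (hs1 : 1 ≤ p / ((n : ℝ≥0∞) - 1)) {σ τ r : NNReal} (hr1 : 1 ≤ r) (hrp : (r : ℝ≥0∞) ≤ p)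
    (hτ : (τ : ℝ)⁻¹ = (r : ℝ)⁻¹ - (n : ℝ)⁻¹)
    (hσ : (σ : ℝ≥0∞)⁻¹ + ((σ : ℝ≥0∞)⁻¹ + (p / ((n : ℝ≥0∞) - 1))⁻¹) = 1)
    (hr : p⁻¹ / 2 + (q⁻¹ / 2 + 2⁻¹) = (r : ℝ≥0∞)⁻¹) {L D K : ℝ≥0∞} (hL : L ≠ ⊤) (hD : D ≠ ⊤)
    (hK : K ≠ ⊤) :
    ∃ C : ℝ≥0∞, C ≠ ⊤ ∧ ∀ (p₀ : ℝ≥0∞) (_ : p / ((n : ℝ≥0∞) - 1) ≤ p₀)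
        (a : EuclideanSpace ℝ (Fin n) → Matrix (Fin n) (Fin n) ℝ)
        (lam d c f u : EuclideanSpace ℝ (Fin n) → ℝ)
        (_ : DegenerateElliptic (Metric.ball 0 1) a lam d)
        (_ : AEStronglyMeasurable lam (volume.restrict (Metric.ball 0 1)))
        (_ : eLpNorm lam p (volume.restrict (Metric.ball 0 1)) ≤ L)
        (_ : AEStronglyMeasurable (fun x => (d x)⁻¹) (volume.restrict (Metric.ball 0 1)))
        (_ : eLpNorm (fun x => (d x)⁻¹) q (volume.restrict (Metric.ball 0 1)) ≤ D)
        (_ : AEStronglyMeasurable c (volume.restrict (Metric.ball 0 1)))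
        (_ : eLpNorm c p₀ (volume.restrict (Metric.ball 0 1)) ≤ K)
        (_ : AEStronglyMeasurable f (volume.restrict (Metric.ball 0 1)))
        (_ : IsWeakSubsolution (Metric.ball 0 1) p a c f u)
        (M : ℝ) (_ : 0 < M)
        (_ : eLpNorm f p₀ (volume.restrict (Metric.ball 0 1)) ≤ ENNReal.ofReal M)
        (N ρ R h k : ℝ) (_ : 1 ≤ N) (_ : 1 / 2 ≤ ρ) (_ : ρ + 1 / N ≤ R) (_ : R ≤ 1) (_ : 0 ≤ h)
        (_ : h + M / N ≤ k) (_ : h ≤ 2 * M),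
      eLpNorm (fun x => max (u x - k) 0) τ (volume.restrict (Metric.ball 0 ρ)) ≤
        C * ENNReal.ofReal N *
          eLpNorm (fun x => max (u x - h) 0) σ (volume.restrict (Metric.ball 0 R)) := by
  obtain ⟨c₀, hc₀, hcut⟩ := exists_cutoff n
  set Ω : Set (EuclideanSpace ℝ (Fin n)) := Metric.ball 0 1 with hΩ
  set s := p / ((n : ℝ≥0∞) - 1) with hs
  have hfin : IsFiniteMeasure (volume.restrict Ω) := ⟨by
    rw [Measure.restrict_apply_univ]; exact measure_ball_lt_top⟩
  set m : ℝ≥0∞ := 1 + volume.restrict Ω Set.univ with hm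
  have hmt : m ≠ ⊤ := ENNReal.add_ne_top.2 ⟨ENNReal.one_ne_top, measure_ne_top _ _⟩
  set CS : ℝ≥0∞ :=
    ((SNormLESNormFDerivOfEqConst ℝ (volume : Measure (EuclideanSpace ℝ (Fin n))) r : NNReal) :
      ℝ≥0∞) with hCS
  -- The three terms bound the contributions of `λ^(n-1)`, `c` and `f`: `2 c₀²` comes from the
  -- cutoff, `5` from `|u| ≤ 5 N w`, and `2` from `M ≤ 2 N w`.
  set Z₀ : ℝ≥0∞ := ENNReal.ofReal (2 * c₀ ^ 2) * L ^ (n - 1) +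
    (ENNReal.ofReal 5 * (K * m) + ENNReal.ofReal 2 * m) with hZ₀
  have hZ₀t : Z₀ ≠ ⊤ := by
    refine ENNReal.add_ne_top.2 ⟨ENNReal.mul_ne_top ENNReal.ofReal_ne_top (ENNReal.pow_ne_top hL),
      ENNReal.add_ne_top.2 ⟨ENNReal.mul_ne_top ENNReal.ofReal_ne_top (ENNReal.mul_ne_top hK hmt),
        ENNReal.mul_ne_top ENNReal.ofReal_ne_top hmt⟩⟩
  refine ⟨CS * (L ^ (1 / 2 : ℝ) * (D ^ (1 / 2 : ℝ) * (9 * Z₀) ^ (1 / 2 : ℝ))), ?_, ?_⟩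
  · have hh : (0 : ℝ) ≤ 1 / 2 := by norm_num
    exact ENNReal.mul_ne_top ENNReal.coe_ne_top (ENNReal.mul_ne_top
      (ENNReal.rpow_ne_top_of_nonneg hh hL) (ENNReal.mul_ne_top
        (ENNReal.rpow_ne_top_of_nonneg hh hD) (ENNReal.rpow_ne_top_of_nonneg hh
          (ENNReal.mul_ne_top (by simp) hZ₀t))))
  intro p₀ hp₀ a lam d c f u ha hlam hlamL hd hdD hc hcK hf hu M hM hfM N ρ R h k hN hρ hρR hR h0
    hhk hhM
  obtain ⟨Du, hDu, hsub⟩ := hu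
  have hN0 : 0 < N := by linarith
  have hMN : 0 < M / N := by positivity
  have hk : h < k := by linarith
  obtain ⟨η, hη, hη01, hη1, hηR, hηg⟩ := hcut N ρ R hN0 hρ hρR hR
  obtain ⟨H, hH, hH0, hHn, hH', hHc, hHk, hHs⟩ := exists_smooth_truncation h0 hk
  have hRΩ : Metric.ball (0 : EuclideanSpace ℝ (Fin n)) R ⊆ Ω := Metric.ball_subset_ball hR
  have hρΩ : Metric.ball (0 : EuclideanSpace ℝ (Fin n)) ρ ⊆ Ω := by
    refine Metric.ball_subset_ball ?_
    have : 0 < 1 / N := by positivity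
    linarith
  have hum := hDu.memLp.1
  set w : EuclideanSpace ℝ (Fin n) → ℝ := fun x => max (u x - h) 0 with hw
  have hwm : AEStronglyMeasurable w (volume.restrict Ω) :=
    (continuous_id.sub continuous_const).max continuous_const |>.comp_aestronglyMeasurable hum
  have hw0 : ∀ x, 0 ≤ w x := fun x => le_max_right _ _
  have hHw : ∀ x, H (u x) ≤ w x := fun x => (hHc (u x)).trans
    (mul_le_of_le_one_right (hw0 x) (hH' _).2)
  set Z : EuclideanSpace ℝ (Fin n) → ℝ := fun x =>
    N ^ 2 * ((2 * c₀ ^ 2) * lam x ^ (n - 1) + (5 * |c x| + (2 / M) * |f x|)) with hZ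
  have hlamn : AEStronglyMeasurable (fun x => lam x ^ (n - 1)) (volume.restrict Ω) := hlam.pow _
  have hZm : AEStronglyMeasurable Z (volume.restrict Ω) :=
    ((hlamn.const_mul _).add ((hc.norm.const_mul _).add (hf.norm.const_mul _))).const_mul _
  have hZs : eLpNorm Z s (volume.restrict Ω) ≤ ENNReal.ofReal (N ^ 2) * Z₀ := by
    have e0 : ∀ (b : ℝ) (hb : 0 ≤ b) (g : EuclideanSpace ℝ (Fin n) → ℝ),
        eLpNorm (fun x => b * g x) s (volume.restrict Ω) =
          ENNReal.ofReal b * eLpNorm g s (volume.restrict Ω) := fun b hb g => by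
      have := eLpNorm_const_smul b g s (volume.restrict Ω)
      rw [Real.enorm_of_nonneg hb] at this
      exact this
    rw [hZ, e0 _ (by positivity)]
    gcongr
    refine (eLpNorm_add_le (hlamn.const_mul _)
      ((hc.norm.const_mul _).add (hf.norm.const_mul _)) hs1).trans ?_
    rw [e0 _ (by positivity), hZ₀]
    refine add_le_add ?_ ?_
    · gcongr
      rw [eLpNorm_pow_sub_one hn]
      gcongr
    · refine (eLpNorm_add_le (hc.norm.const_mul _) (hf.norm.const_mul _) hs1).trans ?_
      rw [e0 _ (by positivity), e0 _ (by positivity)]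
      refine add_le_add ?_ ?_
      · gcongr
        refine (eLpNorm_norm c).trans_le ?_
        refine (eLpNorm_le_eLpNorm_mul_one_add_measure hc hs1 hp₀).trans ?_
        gcongr
      · have h1 : eLpNorm (fun x => |f x|) s (volume.restrict Ω) ≤ ENNReal.ofReal M * m := by
          refine (eLpNorm_norm f).trans_le ?_
          refine (eLpNorm_le_eLpNorm_mul_one_add_measure hf hs1 hp₀).trans ?_
          gcongr
        -- Since `‖f‖ ≤ M`, the division by `M` removes `f` from the constant.
        calc _ ≤ ENNReal.ofReal (2 / M) * (ENNReal.ofReal M * m) := mul_le_mul' le_rfl h1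
          _ = _ := by
            rw [← mul_assoc, ← ENNReal.ofReal_mul (by positivity), div_mul_cancel₀ _ hM.ne']
  set g : EuclideanSpace ℝ (Fin n) → ℝ≥0∞ := fun x => ENNReal.ofReal (w x * (w x * Z x)) with hg
  set I : ℝ≥0∞ := ∫⁻ x in Metric.ball 0 R, g x with hI
  set E : ℝ≥0∞ := eLpNorm w σ (volume.restrict (Metric.ball 0 R)) with hE
  have hIE : I ≤ E * (E * (ENNReal.ofReal (N ^ 2) * Z₀)) := by
    have hmono : volume.restrict (Metric.ball 0 R) ≤ volume.restrict Ω :=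
      Measure.restrict_mono hRΩ le_rfl
    have h1 := lintegral_enorm_mul_mul_le hσ (hwm.mono_measure hmono) (hZm.mono_measure hmono)
    have h2 : eLpNorm Z s (volume.restrict (Metric.ball 0 R)) ≤ ENNReal.ofReal (N ^ 2) * Z₀ :=
      (eLpNorm_mono_measure _ hmono).trans hZs
    refine (lintegral_mono fun x => ?_).trans (h1.trans (by gcongr))
    exact Real.ofReal_le_enorm _
  set S₁ : EuclideanSpace ℝ (Fin n) → ℝ := fun x =>
    2 * max (u x - h) 0 ^ 2 * (lam x ^ (n - 1) * ‖gradient η x‖ ^ 2) +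
        |c x| * |u x| * (η x ^ 2 * H (u x)) with hS₁
  set S₂ : EuclideanSpace ℝ (Fin n) → ℝ := fun x => |f x * (η x * η x * H (u x))| with hS₂
  have hSle : ∀ᵐ x ∂(volume.restrict Ω), x ∈ Metric.ball (0 : EuclideanSpace ℝ (Fin n)) R →
      S₁ x ≤ w x * (w x * Z x) ∧ S₂ x ≤ w x * (w x * Z x) := by
    filter_upwards [ha.lam_pos] with x hlx hxR
    have hη2 : η x ^ 2 ≤ 1 := pow_le_one₀ (hη01 x).1 (hη01 x).2
    have hlp : 0 ≤ lam x ^ (n - 1) := by positivity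
    have hgr : ‖gradient η x‖ ^ 2 ≤ c₀ ^ 2 * N ^ 2 := by
      rw [← mul_pow]; exact pow_le_pow_left₀ (norm_nonneg _) (hηg x) 2
    have hN2 : N ≤ N ^ 2 := by nlinarith
    have hgap : M / (2 * N) ≤ (k - h) / 2 := by
      have : M / (2 * N) = M / N / 2 := by field_simp
      rw [this]; linarith
    have t1 : 2 * w x ^ 2 * (lam x ^ (n - 1) * ‖gradient η x‖ ^ 2) ≤
        w x ^ 2 * (N ^ 2 * ((2 * c₀ ^ 2) * lam x ^ (n - 1))) := by
      calc 2 * w x ^ 2 * (lam x ^ (n - 1) * ‖gradient η x‖ ^ 2)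
          ≤ 2 * w x ^ 2 * (lam x ^ (n - 1) * (c₀ ^ 2 * N ^ 2)) := by gcongr
        _ = _ := by ring
    -- Where `H(u)` is nonzero, `w` is at least half the gap of levels, hence at least `M/(2N)`.
    -- With `h ≤ 2M` this gives `|u| ≤ w + 2M ≤ 5 N w`.
    have key : H (u x) ≠ 0 → M ≤ 2 * N * w x ∧ |u x| ≤ 5 * N * w x := by
      intro hne
      have h1 : (k - h) / 2 ≤ u x - h := hHs _ hne
      have h2 : M / (2 * N) ≤ w x := hgap.trans (h1.trans (le_max_left _ _))
      have h3 : M ≤ 2 * N * w x := by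
        rw [div_le_iff₀ (by positivity)] at h2; linarith
      refine ⟨h3, ?_⟩
      have h4 : u x ≤ w x + h := by
        have : u x - h ≤ w x := le_max_left _ _
        linarith
      rw [abs_of_nonneg (by linarith)]
      have : w x ≤ N * w x := le_mul_of_one_le_left (hw0 x) hN
      linarith
    have hηH : η x ^ 2 * H (u x) ≤ w x :=
      (mul_le_of_le_one_left (hHn _) hη2).trans (hHw x)
    have hηH0 : 0 ≤ η x ^ 2 * H (u x) := mul_nonneg (sq_nonneg _) (hHn _)
    have t2 : |c x| * |u x| * (η x ^ 2 * H (u x)) ≤ w x ^ 2 * (N ^ 2 * (5 * |c x|)) := by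
      by_cases hne : H (u x) = 0
      · rw [hne, mul_zero, mul_zero]; positivity
      · calc |c x| * |u x| * (η x ^ 2 * H (u x)) ≤ |c x| * (5 * N ^ 2 * w x) * w x := by
              gcongr
              refine (key hne).2.trans ?_
              have := hw0 x
              gcongr
          _ = _ := by ring
    -- This term is only linear in `w`; it becomes quadratic after multiplication by `2 N² w / M ≥
    -- 1`.
    have t3 : |f x| * (η x ^ 2 * H (u x)) ≤ w x ^ 2 * (N ^ 2 * ((2 / M) * |f x|)) := by
      by_cases hne : H (u x) = 0
      · rw [hne, mul_zero, mul_zero]; positivity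
      · have h5 : 1 ≤ N ^ 2 * (2 / M) * w x := by
          rw [mul_div_assoc', div_mul_eq_mul_div, one_le_div hM]
          have := mul_le_mul_of_nonneg_right hN2 (hw0 x)
          linarith [(key hne).1]
        calc |f x| * (η x ^ 2 * H (u x)) ≤ |f x| * w x := by gcongr
          _ ≤ |f x| * w x * (N ^ 2 * (2 / M) * w x) :=
              le_mul_of_one_le_right (mul_nonneg (abs_nonneg _) (hw0 x)) h5
          _ = _ := by ring
    have p1 : 0 ≤ w x ^ 2 * (N ^ 2 * ((2 * c₀ ^ 2) * lam x ^ (n - 1))) := by positivity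
    have p2 : 0 ≤ w x ^ 2 * (N ^ 2 * (5 * |c x|)) := by positivity
    have p3 : 0 ≤ w x ^ 2 * (N ^ 2 * ((2 / M) * |f x|)) := by positivity
    have hsplit : w x * (w x * Z x) = w x ^ 2 * (N ^ 2 * ((2 * c₀ ^ 2) * lam x ^ (n - 1))) +
        w x ^ 2 * (N ^ 2 * (5 * |c x|)) + w x ^ 2 * (N ^ 2 * ((2 / M) * |f x|)) := by
      simp only [hZ]; ring
    rw [hsplit]
    constructor
    · have : S₁ x ≤ _ := add_le_add t1 t2
      linarith
    · have : S₂ x = |f x| * (η x ^ 2 * H (u x)) := by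
        simp only [hS₂]
        rw [abs_mul, ← sq, abs_of_nonneg hηH0]
      linarith
  have hS₁I : ∫⁻ x in Ω, ENNReal.ofReal (S₁ x) ≤ I := by
    refine lintegral_le_of_le_indicator measurableSet_ball hRΩ ?_
    filter_upwards [hSle] with x hx
    by_cases hxR : x ∈ Metric.ball (0 : EuclideanSpace ℝ (Fin n)) R
    · rw [Set.indicator_of_mem hxR]
      exact ENNReal.ofReal_le_ofReal (hx hxR).1
    · simp [hS₁, hηR x hxR]
  have hS₂I : ∫⁻ x in Ω, ENNReal.ofReal (S₂ x) ≤ I := by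
    refine lintegral_le_of_le_indicator measurableSet_ball hRΩ ?_
    filter_upwards [hSle] with x hx
    by_cases hxR : x ∈ Metric.ball (0 : EuclideanSpace ℝ (Fin n)) R
    · rw [Set.indicator_of_mem hxR]
      exact ENNReal.ofReal_le_ofReal (hx hxR).2
    · simp [hS₂, hηR x hxR]
  have hcac := caccioppoli Metric.isOpen_ball hp1 hp ha hlam hc hDu hsub hη hH hH0 hHn hH' hHc
  set P : EuclideanSpace ℝ (Fin n) → ℝ := fun x =>
    η x ^ 2 * deriv H (u x) * (d x / lam x * ‖Du x‖ ^ 2) / 2 with hP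
  have hPI : ∫⁻ x in Ω, ENNReal.ofReal (P x) ≤ 2 * I := by
    refine hcac.trans ?_
    rw [two_mul]
    exact add_le_add hS₁I hS₂I
  set W : EuclideanSpace ℝ (Fin n) → EuclideanSpace ℝ (Fin n) := fun x =>
    (η x * deriv H (u x)) • Du x + H (u x) • gradient η x with hWdef
  have hW : HasSobolevGradientZero Ω p (fun x => η x * H (u x)) W :=
    hDu.mul_comp Metric.isOpen_ball hp1 hp hη hH hH0 (B := 1) fun t => by
      rw [abs_of_nonneg (hH' t).1]; exact (hH' t).2
  -- Four times the Caccioppoli bound `2 I`, plus one `I` for the gradient of the cutoff, gives `9`.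
  have hWI : ∫⁻ x in Ω, ENNReal.ofReal (d x / lam x * ‖W x‖ ^ 2) ≤ 9 * I := by
    have hpt : ∀ᵐ x ∂(volume.restrict Ω), ENNReal.ofReal (d x / lam x * ‖W x‖ ^ 2) ≤
        4 * ENNReal.ofReal (P x) + (Metric.ball 0 R).indicator g x := by
      filter_upwards [hSle, ha.lam_pos, ha.d_pos, ha.div_le (by omega)] with x hx hlx hdx hdl
      have hdl0 : 0 ≤ d x / lam x := by positivity
      have hP0 : 0 ≤ P x := by
        have := (hH' (u x)).1
        simp only [hP]; positivity
      have h1 : ‖W x‖ ^ 2 ≤ 2 * (η x ^ 2 * deriv H (u x) * ‖Du x‖ ^ 2) +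
          2 * (w x ^ 2 * ‖gradient η x‖ ^ 2) := by
        have h2 : ‖W x‖ ≤ η x * deriv H (u x) * ‖Du x‖ + H (u x) * ‖gradient η x‖ := by
          refine (norm_add_le _ _).trans_eq ?_
          rw [norm_smul, norm_smul, Real.norm_of_nonneg (mul_nonneg (hη01 x).1 (hH' _).1),
            Real.norm_of_nonneg (hHn _)]
        have h3 : ‖W x‖ ^ 2 ≤ 2 * (η x * deriv H (u x) * ‖Du x‖) ^ 2 +
            2 * (H (u x) * ‖gradient η x‖) ^ 2 := by
          refine (pow_le_pow_left₀ (norm_nonneg _) h2 2).trans ?_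
          nlinarith [sq_nonneg (η x * deriv H (u x) * ‖Du x‖ - H (u x) * ‖gradient η x‖)]
        refine h3.trans ?_
        rw [mul_pow, mul_pow, mul_pow]
        have h4 : deriv H (u x) ^ 2 ≤ deriv H (u x) := by
          nlinarith [(hH' (u x)).1, (hH' (u x)).2]
        have h5 : H (u x) ^ 2 ≤ w x ^ 2 := pow_le_pow_left₀ (hHn _) (hHw x) 2
        gcongr
      have h6 : d x / lam x * ‖W x‖ ^ 2 ≤ 4 * P x + S₁ x := by
        calc d x / lam x * ‖W x‖ ^ 2 ≤ d x / lam x * (2 * (η x ^ 2 * deriv H (u x) * ‖Du x‖ ^ 2) +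
              2 * (w x ^ 2 * ‖gradient η x‖ ^ 2)) := by gcongr
          _ = 4 * P x + d x / lam x * (2 * (w x ^ 2 * ‖gradient η x‖ ^ 2)) := by
              simp only [hP]; ring
          _ ≤ 4 * P x + lam x ^ (n - 1) * (2 * (w x ^ 2 * ‖gradient η x‖ ^ 2)) := by gcongr
          _ = 4 * P x + 2 * w x ^ 2 * (lam x ^ (n - 1) * ‖gradient η x‖ ^ 2) := by ring
          _ ≤ 4 * P x + S₁ x := by
              have : 0 ≤ |c x| * |u x| * (η x ^ 2 * H (u x)) :=
                mul_nonneg (by positivity) (mul_nonneg (sq_nonneg _) (hHn _))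
              simp only [hS₁]
              linarith
      refine (ENNReal.ofReal_le_ofReal h6).trans (ENNReal.ofReal_add_le.trans (add_le_add ?_ ?_))
      · rw [ENNReal.ofReal_mul (by norm_num)]
        simp
      · by_cases hxR : x ∈ Metric.ball (0 : EuclideanSpace ℝ (Fin n)) R
        · rw [Set.indicator_of_mem hxR]
          exact ENNReal.ofReal_le_ofReal (hx hxR).1
        · simp [hS₁, hηR x hxR]
    refine (lintegral_mono_ae hpt).trans ?_
    have hgm : AEMeasurable g (volume.restrict Ω) :=
      (hwm.mul (hwm.mul hZm)).aemeasurable.ennreal_ofReal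
    rw [lintegral_add_right' _ (hgm.indicator measurableSet_ball),
      lintegral_const_mul' _ _ (by simp)]
    have h7 : ∫⁻ x in Ω, (Metric.ball 0 R).indicator g x ≤ I :=
      lintegral_le_of_le_indicator measurableSet_ball hRΩ (Eventually.of_forall fun x => le_rfl)
    calc _ ≤ 4 * (2 * I) + I := by gcongr
      _ = 9 * I := by ring
  have hgns := hW.eLpNorm_le (by omega) hp hr1 hrp hτ
  have hwt := eLpNorm_le_of_weight hr hlam hd hW.memLp_grad.1 ha.lam_pos ha.d_pos
  have hleft : eLpNorm (fun x => max (u x - k) 0) τ (volume.restrict (Metric.ball 0 ρ)) ≤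
      eLpNorm (fun x => η x * H (u x)) τ (volume.restrict Ω) := by
    refine (eLpNorm_mono_ae ?_).trans (eLpNorm_mono_measure _ (Measure.restrict_mono hρΩ le_rfl))
    filter_upwards [ae_restrict_mem measurableSet_ball] with x hx
    rw [hη1 x hx, one_mul, Real.norm_of_nonneg (le_max_right _ _), Real.norm_of_nonneg (hHn _)]
    exact hHk _
  refine hleft.trans (hgns.trans ?_)
  -- `I` is quadratic in `N` and in the norm of `w`, so the square root is linear in both.
  have hsq : (9 * I) ^ (1 / 2 : ℝ) ≤ (9 * Z₀) ^ (1 / 2 : ℝ) * (ENNReal.ofReal N * E) := by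
    have h1 : 9 * I ≤ (9 * Z₀) * (ENNReal.ofReal N * E) ^ (2 : ℝ) := by
      calc 9 * I ≤ 9 * (E * (E * (ENNReal.ofReal (N ^ 2) * Z₀))) := by gcongr
        _ = _ := by
          rw [ENNReal.ofReal_pow hN0.le, ENNReal.rpow_two]; ring
    refine (ENNReal.rpow_le_rpow h1 (by norm_num)).trans_eq ?_
    rw [ENNReal.mul_rpow_of_nonneg _ _ (by norm_num), ← ENNReal.rpow_mul]
    norm_num
  calc CS * eLpNorm W r (volume.restrict Ω)
      ≤ CS * (L ^ (1 / 2 : ℝ) * (D ^ (1 / 2 : ℝ) *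
          ((9 * Z₀) ^ (1 / 2 : ℝ) * (ENNReal.ofReal N * E)))) := by
        gcongr
        refine hwt.trans ?_
        gcongr
        exact (ENNReal.rpow_le_rpow hWI (by norm_num)).trans hsq
    _ = _ := by ring

end Step

/-! ### De Giorgi iteration -/

section DeGiorgi

open Filter Topology

/-- Hölder's inequality on a set containing `{u > k}`, whose measure Chebyshev's inequality bounds
through `(u - h)⁺ ≥ g`. The exponent is `σ (1/σ - 1/τ) = 1 - σ/τ`. -/
theorem eLpNorm_truncation_le {α : Type*} [MeasurableSpace α] {μ ν : Measure α} (hμν : μ ≤ ν)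
    {u : α → ℝ} (hu : AEStronglyMeasurable u ν) {σ τ : NNReal} (hσ : 1 ≤ σ) (hστ : σ < τ)
    {h k g : ℝ} (hg : 0 < g) (hk : h + g ≤ k) :
    eLpNorm (fun x => max (u x - k) 0) σ μ ≤ eLpNorm (fun x => max (u x - k) 0) τ μ *
      ((ENNReal.ofReal g)⁻¹ * eLpNorm (fun x => max (u x - h) 0) σ ν) ^ (1 - σ / τ : ℝ) := by
  have hσ0 : (0 : ℝ) < σ := by exact_mod_cast zero_lt_one.trans_le hσ
  have hτ0 : (0 : ℝ) < τ := hσ0.trans (by exact_mod_cast hστ)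
  have hm : ∀ k, AEStronglyMeasurable (fun x => max (u x - k) 0) ν := fun k =>
    (continuous_id.sub continuous_const).max continuous_const |>.comp_aestronglyMeasurable hu
  set S : Set α := {x | ENNReal.ofReal g ≤ ‖max (u x - h) 0‖ₑ} with hS
  have hsupp : Function.support (fun x => max (u x - k) 0) ⊆ S := by
    intro x hx
    have h1 : k < u x := by
      by_contra hlt
      exact hx (max_eq_right (by linarith))
    simp only [hS, Set.mem_ofPred_eq]
    rw [Real.enorm_of_nonneg (le_max_right _ _)]
    exact ENNReal.ofReal_le_ofReal (le_trans (by linarith) (le_max_left _ _))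
  have hexp : (0 : ℝ) ≤ 1 / σ - 1 / τ :=
    sub_nonneg.2 (one_div_le_one_div_of_le hσ0 (by exact_mod_cast hστ.le))
  have hcheb := meas_ge_le_mul_pow_eLpNorm_enorm ν (p := (σ : ℝ≥0∞))
    (by simpa using hσ0.ne') ENNReal.coe_ne_top (hm h) (ε := ENNReal.ofReal g) (by simpa using hg)
    (by simp)
  calc eLpNorm (fun x => max (u x - k) 0) σ μ
      = eLpNorm (fun x => max (u x - k) 0) σ (μ.restrict S) :=
        (eLpNorm_restrict_eq_of_support_subset hsupp).symm
    _ ≤ eLpNorm (fun x => max (u x - k) 0) τ (μ.restrict S) *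
          (μ.restrict S) Set.univ ^ (1 / (σ : ℝ≥0∞).toReal - 1 / (τ : ℝ≥0∞).toReal) :=
        eLpNorm_le_eLpNorm_mul_rpow_measure_univ (by exact_mod_cast hστ.le)
          ((hm k).mono_measure (Measure.restrict_le_self.trans hμν))
    _ ≤ eLpNorm (fun x => max (u x - k) 0) τ μ *
          ((ENNReal.ofReal g)⁻¹ ^ (σ : ℝ) *
            eLpNorm (fun x => max (u x - h) 0) σ ν ^ (σ : ℝ)) ^ (1 / σ - 1 / τ : ℝ) := by
        simp only [ENNReal.coe_toReal]
        refine mul_le_mul' (eLpNorm_mono_measure _ Measure.restrict_le_self)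
          (ENNReal.rpow_le_rpow ?_ hexp)
        rw [Measure.restrict_apply_univ]
        exact (hμν S).trans hcheb
    _ = _ := by
        rw [← ENNReal.mul_rpow_of_nonneg _ _ hσ0.le, ← ENNReal.rpow_mul]
        congr 2
        field_simp

variable {n : ℕ}

/-- The `L^s` norm of `(u - k)⁺` on the ball of radius `r`. -/
noncomputable def truncNorm (u : EuclideanSpace ℝ (Fin n) → ℝ) (s : ℝ≥0∞) (r k : ℝ) : ℝ≥0∞ :=
  eLpNorm (fun x => max (u x - k) 0) s (volume.restrict (Metric.ball 0 r))

theorem truncNorm_mono (u : EuclideanSpace ℝ (Fin n) → ℝ) (s : ℝ≥0∞) {r r' k k' : ℝ}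
    (hr : r ≤ r') (hk : k' ≤ k) : truncNorm u s r k ≤ truncNorm u s r' k' := by
  refine (eLpNorm_mono_real fun x => ?_).trans
    (eLpNorm_mono_measure _ (Measure.restrict_mono (Metric.ball_subset_ball hr) le_rfl))
  rw [Real.norm_of_nonneg (le_max_right _ _)]
  exact max_le_max (by linarith) le_rfl

/-- De Giorgi's iteration. -/
theorem ae_le_of_truncNorm_le {u : EuclideanSpace ℝ (Fin n) → ℝ}
    (hu : AEStronglyMeasurable u (volume.restrict (Metric.ball 0 1))) {σ τ : NNReal} (hσ : 1 ≤ σ)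
    (hστ : σ < τ) {C M : ℝ} (hC : 0 < C) (hM : 0 < M)
    (hstep : ∀ N ρ R h k : ℝ, 1 ≤ N → 1 / 2 ≤ ρ → ρ + 1 / N ≤ R → R ≤ 1 → 0 ≤ h → h + M / N ≤ k →
      h ≤ 2 * M → truncNorm u τ ρ k ≤ ENNReal.ofReal C * ENNReal.ofReal N * truncNorm u σ R h)
    {ρ R : ℝ} (hρ : 1 / 2 ≤ ρ) (hρR : ρ < R) (hR : R ≤ 1) {θ : ℝ} (hθ : θ = 1 - σ / τ) {ε : ℝ}
    (hε : 0 < ε) (hεC : C * (4 / (R - ρ) ^ 2) * ε ^ θ ≤ (1 / 4 : ℝ) ^ (1 / θ))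
    (h0 : truncNorm u σ R 0 ≤ ENNReal.ofReal (M * ε)) :
    ∀ᵐ x ∂(volume.restrict (Metric.ball 0 ρ)), u x ≤ 2 * M := by
  have hσ0 : (0 : ℝ) < σ := by exact_mod_cast zero_lt_one.trans_le hσ
  have hτ0 : (0 : ℝ) < τ := hσ0.trans (by exact_mod_cast hστ)
  have hθ0 : 0 < θ := by
    rw [hθ, sub_pos, div_lt_one hτ0]; exact_mod_cast hστ
  have hθ1 : θ ≤ 1 := by
    rw [hθ]; have : (0 : ℝ) ≤ σ / τ := by positivity
    linarith
  -- The decay ratio satisfies `κ^θ = 1/4`: each step gains a factor `4^(-j)`, which offsets the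
  -- growth `N² ~ 4^j` of the constants.
  set κ : ℝ := (1 / 4 : ℝ) ^ (1 / θ) with hκ
  have hκ0 : 0 < κ := by positivity
  have hκ1 : κ < 1 := Real.rpow_lt_one (by norm_num) (by norm_num) (by positivity)
  have hκθ : κ ^ θ = 1 / 4 := by
    rw [hκ, ← Real.rpow_mul (by norm_num), one_div_mul_cancel hθ0.ne', Real.rpow_one]
  set Δ := R - ρ with hΔ
  have hΔ0 : 0 < Δ := sub_pos.2 hρR
  have hΔ1 : Δ ≤ 1 := by rw [hΔ]; linarith
  set Rj : ℕ → ℝ := fun j => ρ + Δ * (1 / 2) ^ j with hRj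
  -- Levels rise from `M` to `2M`, so they stay in the range allowed by the step inequality.
  set kj : ℕ → ℝ := fun j => M * (2 - (1 / 2) ^ j) with hkj
  have hpow : ∀ j : ℕ, (0 : ℝ) < (1 / 2) ^ j := fun j => by positivity
  have hpow1 : ∀ j : ℕ, ((1 : ℝ) / 2) ^ j ≤ 1 := fun j => pow_le_one₀ (by norm_num) (by norm_num)
  have claim : ∀ j, truncNorm u σ (Rj j) (kj j) ≤ ENNReal.ofReal (M * ε * κ ^ j) := by
    intro j
    induction j with
    | zero =>
      refine (truncNorm_mono u σ ?_ ?_).trans (h0.trans_eq ?_)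
      · simp [hRj, hΔ]
      · simp only [hkj, pow_zero]; linarith
      · simp
    | succ j ih =>
      -- `1/N` is exactly the gap between consecutive radii; as `Δ ≤ 1`, the gap of levels is at
      -- least `M/N`.
      set N : ℝ := 2 * 2 ^ j / Δ with hN
      have h2j : (1 : ℝ) ≤ 2 ^ j := one_le_pow₀ (by norm_num)
      have hN1 : 1 ≤ N := by
        rw [hN, le_div_iff₀ hΔ0]; linarith
      have hN0 : 0 < N := by linarith
      have hNinv : 1 / N = Δ * (1 / 2) ^ (j + 1) := by
        rw [hN, one_div_div, pow_succ, div_pow, one_pow]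
        field_simp
      have hgap : M / N ≤ kj (j + 1) - kj j := by
        have e1 : M / N = M * (Δ * (1 / 2) ^ (j + 1)) := by
          rw [← hNinv]; ring
        have e2 : kj (j + 1) - kj j = M * (1 / 2) ^ (j + 1) := by
          simp only [hkj, pow_succ]; ring
        rw [e1, e2]
        have := hpow (j + 1)
        gcongr
        exact mul_le_of_le_one_left this.le hΔ1
      have hst := hstep N (Rj (j + 1)) (Rj j) (kj j) (kj (j + 1)) hN1
        (by have := mul_pos hΔ0 (hpow (j + 1)); simp only [hRj]; linarith)
        (by rw [hNinv]; simp only [hRj, pow_succ]; linarith)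
        (by
          have := mul_le_of_le_one_right hΔ0.le (hpow1 j)
          simp only [hRj]; linarith)
        (mul_nonneg hM.le (by linarith [hpow1 j])) (by linarith)
        (by
          have := mul_pos hM (hpow j)
          simp only [hkj]; linarith)
      have hball : volume.restrict (Metric.ball (0 : EuclideanSpace ℝ (Fin n)) (Rj (j + 1))) ≤
          volume.restrict (Metric.ball 0 (Rj j)) := by
        refine Measure.restrict_mono (Metric.ball_subset_ball ?_) le_rfl
        have : Δ * (1 / 2) ^ (j + 1) ≤ Δ * (1 / 2) ^ j := by
          rw [pow_succ]; nlinarith [mul_pos hΔ0 (hpow j)]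
        simp only [hRj]; linarith
      have hRj1 : Rj j ≤ 1 := by
        have := mul_le_of_le_one_right hΔ0.le (hpow1 j)
        simp only [hRj]; linarith
      have htr := eLpNorm_truncation_le hball
        (hu.mono_measure (Measure.restrict_mono (Metric.ball_subset_ball hRj1) le_rfl)) hσ hστ
        (h := kj j) (k := kj (j + 1)) (g := M / N) (by positivity) (by linarith)
      rw [← hθ] at htr
      have hx0 : 0 ≤ M * ε * κ ^ j := by positivity
      have hA : truncNorm u σ (Rj (j + 1)) (kj (j + 1)) ≤ ENNReal.ofReal
          (C * N * (M * ε * κ ^ j) * ((M / N)⁻¹ * (M * ε * κ ^ j)) ^ θ) := by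
        refine htr.trans ?_
        generalize M * ε * κ ^ j = X at hx0 ih
        rw [ENNReal.ofReal_mul (by positivity), ENNReal.ofReal_mul (by positivity),
          ENNReal.ofReal_mul (by positivity), ← ENNReal.ofReal_rpow_of_nonneg (by positivity) hθ0.le,
          ENNReal.ofReal_mul (by positivity), ENNReal.ofReal_inv_of_pos (by positivity)]
        refine mul_le_mul' (hst.trans (mul_le_mul' le_rfl ih)) (ENNReal.rpow_le_rpow ?_ hθ0.le)
        exact mul_le_mul' le_rfl ih
      refine hA.trans (ENNReal.ofReal_le_ofReal ?_)
      have e1 : (M / N)⁻¹ * (M * ε * κ ^ j) = N * (ε * κ ^ j) := by field_simp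
      -- The bound `N^θ ≤ N` is lossy, but makes the total power of `N` equal to two.
      have e2 : (N * (ε * κ ^ j)) ^ θ ≤ N * (ε ^ θ * (1 / 4) ^ j) := by
        rw [Real.mul_rpow hN0.le (by positivity), Real.mul_rpow hε.le (by positivity),
          ← Real.rpow_natCast κ j, ← Real.rpow_mul hκ0.le, mul_comm (j : ℝ) θ,
          Real.rpow_mul hκ0.le, hκθ, Real.rpow_natCast]
        gcongr
        calc N ^ θ ≤ N ^ (1 : ℝ) := Real.rpow_le_rpow_of_exponent_le hN1 hθ1
          _ = N := Real.rpow_one N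
      have e3 : N * N * (1 / 4) ^ j = 4 / Δ ^ 2 := by
        rw [hN, div_pow, one_pow, show (4 : ℝ) ^ j = 2 ^ j * 2 ^ j by rw [← mul_pow]; norm_num]
        field_simp
        norm_num
      rw [e1]
      calc C * N * (M * ε * κ ^ j) * (N * (ε * κ ^ j)) ^ θ
          ≤ C * N * (M * ε * κ ^ j) * (N * (ε ^ θ * (1 / 4) ^ j)) := by gcongr
        _ = (C * (N * N * (1 / 4) ^ j) * ε ^ θ) * (M * ε * κ ^ j) := by ring
        _ ≤ κ * (M * ε * κ ^ j) := by
            rw [e3]; exact mul_le_mul_of_nonneg_right hεC hx0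
        _ = M * ε * κ ^ (j + 1) := by rw [pow_succ]; ring
  have hlim : Tendsto (fun j : ℕ => ENNReal.ofReal (M * ε * κ ^ j)) atTop (𝓝 0) := by
    have := (tendsto_pow_atTop_nhds_zero_of_lt_one hκ0.le hκ1).const_mul (M * ε)
    rw [mul_zero] at this
    have h2 := (ENNReal.continuous_ofReal.tendsto 0).comp this
    rwa [ENNReal.ofReal_zero] at h2
  have hzero : truncNorm u σ ρ (2 * M) = 0 := by
    refine le_antisymm (ge_of_tendsto' hlim fun j => ?_) zero_le
    refine (truncNorm_mono u σ ?_ ?_).trans (claim j)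
    · have := mul_pos hΔ0 (hpow j)
      simp only [hRj]; linarith
    · have := mul_pos hM (hpow j)
      simp only [hkj]; linarith
  have hum : AEStronglyMeasurable (fun x => max (u x - 2 * M) 0)
      (volume.restrict (Metric.ball 0 ρ)) :=
    (continuous_id.sub continuous_const).max continuous_const |>.comp_aestronglyMeasurable
      (hu.mono_measure (Measure.restrict_mono (Metric.ball_subset_ball (by linarith)) le_rfl))
  have hae := (eLpNorm_eq_zero_iff hum (by simpa using hσ0.ne')).1 hzero
  filter_upwards [hae] with x hx
  have h1 : u x - 2 * M ≤ max (u x - 2 * M) 0 := le_max_left _ _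
  have h2 : max (u x - 2 * M) 0 = 0 := hx
  linarith

end DeGiorgi

/-! ### From the `L^σ` norm to the `L^1` norm -/

section LocalMaximum

open Filter Topology

/-- A form of Young's inequality: with `y = (a/t)^σ U`, both `S` and `y` are at most `S + y`, so
`S^(σ-1) y ≤ (S + y)^σ`. The free parameter `t` makes the coefficient of `S` small. -/
theorem mul_rpow_le_add {σ a t S U : ℝ} (hσ : 1 ≤ σ) (ha : 0 < a) (ht : 0 < t) (hS : 0 ≤ S)
    (hU : 0 ≤ U) : a * (S ^ (σ - 1) * U) ^ (1 / σ) ≤ t * S + t * (a / t) ^ σ * U := by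
  have hσ0 : 0 < σ := by linarith
  set y := (a / t) ^ σ * U with hy
  have hat : 0 < a / t := by positivity
  have hy0 : 0 ≤ y := by positivity
  have h1 : (a / t) ^ σ * (S ^ (σ - 1) * U) ≤ (S + y) ^ σ := by
    calc (a / t) ^ σ * (S ^ (σ - 1) * U) = S ^ (σ - 1) * y := by rw [hy]; ring
      _ ≤ (S + y) ^ (σ - 1) * (S + y) ^ (1 : ℝ) := by
          rw [Real.rpow_one]
          gcongr
          · linarith
          · linarith
      _ = (S + y) ^ σ := by
          rw [← Real.rpow_add_of_nonneg (by positivity) (by linarith) zero_le_one]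
          congr 1; ring
  have h2 := Real.rpow_le_rpow (by positivity) h1 (by positivity : 0 ≤ 1 / σ)
  rw [Real.mul_rpow (by positivity) (by positivity), ← Real.rpow_mul hat.le,
    ← Real.rpow_mul (by positivity), mul_one_div_cancel hσ0.ne', Real.rpow_one, Real.rpow_one] at h2
  calc a * (S ^ (σ - 1) * U) ^ (1 / σ) = t * (a / t * (S ^ (σ - 1) * U) ^ (1 / σ)) := by
        field_simp
    _ ≤ t * (S + y) := by gcongr
    _ = _ := by rw [hy]; ring

variable {n : ℕ}

/-- Interpolation of `L^σ` between `L^1` and `L^∞`. -/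
theorem truncNorm_le_interpolate {u : EuclideanSpace ℝ (Fin n) → ℝ} {σ : NNReal} (hσ : 1 ≤ σ)
    {R S U : ℝ} (hR : R ≤ 1) (hS : 0 ≤ S) (hU0 : 0 ≤ U) (hU : truncNorm u 1 1 0 ≤ ENNReal.ofReal U)
    (huS : ∀ᵐ x ∂(volume.restrict (Metric.ball 0 R)), u x ≤ S) :
    truncNorm u σ R 0 ≤ ENNReal.ofReal ((S ^ ((σ : ℝ) - 1) * U) ^ (1 / (σ : ℝ))) := by
  have hσ1 : (1 : ℝ) ≤ σ := by exact_mod_cast hσ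
  have hσ0 : (0 : ℝ) < σ := by linarith
  have hU' : ∫⁻ x in Metric.ball 0 R, ‖max (u x - 0) 0‖ₑ ≤ ENNReal.ofReal U := by
    rw [← eLpNorm_one_eq_lintegral_enorm]
    exact (truncNorm_mono u 1 hR le_rfl).trans hU
  rw [truncNorm, eLpNorm_eq_lintegral_rpow_enorm_toReal (by simpa using hσ0.ne')
    ENNReal.coe_ne_top, ENNReal.coe_toReal, ← ENNReal.ofReal_rpow_of_nonneg (by positivity)
    (by positivity), ENNReal.ofReal_mul (by positivity),
    ← ENNReal.ofReal_rpow_of_nonneg hS (by linarith)]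
  refine ENNReal.rpow_le_rpow ?_ (by positivity)
  calc ∫⁻ x in Metric.ball 0 R, ‖max (u x - 0) 0‖ₑ ^ (σ : ℝ)
      ≤ ∫⁻ x in Metric.ball 0 R, ENNReal.ofReal S ^ ((σ : ℝ) - 1) * ‖max (u x - 0) 0‖ₑ := by
        refine lintegral_mono_ae ?_
        filter_upwards [huS] with x hx
        have h1 : ‖max (u x - 0) 0‖ₑ ≤ ENNReal.ofReal S := by
          rw [Real.enorm_of_nonneg (le_max_right _ _)]
          exact ENNReal.ofReal_le_ofReal (max_le (by linarith) hS)
        calc ‖max (u x - 0) 0‖ₑ ^ (σ : ℝ) = ‖max (u x - 0) 0‖ₑ ^ (((σ : ℝ) - 1) + 1) := by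
              congr 1; ring
          _ = ‖max (u x - 0) 0‖ₑ ^ ((σ : ℝ) - 1) * ‖max (u x - 0) 0‖ₑ := by
              rw [ENNReal.rpow_add_of_nonneg _ _ (by linarith) zero_le_one, ENNReal.rpow_one]
          _ ≤ _ := mul_le_mul' (ENNReal.rpow_le_rpow h1 (by linarith)) le_rfl
    _ = ENNReal.ofReal S ^ ((σ : ℝ) - 1) * ∫⁻ x in Metric.ball 0 R, ‖max (u x - 0) 0‖ₑ :=
        lintegral_const_mul' _ _ (ENNReal.rpow_ne_top_of_nonneg (by linarith) ENNReal.ofReal_ne_top)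
    _ ≤ _ := mul_le_mul' le_rfl hU'

/-- A function satisfying the gain of integrability at every scale is bounded above. -/
theorem exists_ae_le_of_step {σ τ : NNReal} (hσ : 1 ≤ σ) (hστ : σ < τ) {C : ℝ} (hC : 0 < C) :
    ∃ C' : ℝ, 0 < C' ∧ ∀ (u : EuclideanSpace ℝ (Fin n) → ℝ)
      (_ : AEStronglyMeasurable u (volume.restrict (Metric.ball 0 1))) (U F : ℝ) (_ : 0 ≤ U)
      (_ : 0 < F) (_ : truncNorm u 1 1 0 ≤ ENNReal.ofReal U)
      (_ : truncNorm u σ (7 / 8) 0 ≠ ⊤)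
      (_ : ∀ M, F ≤ M → ∀ N ρ R h k : ℝ, 1 ≤ N → 1 / 2 ≤ ρ → ρ + 1 / N ≤ R → R ≤ 1 → 0 ≤ h →
        h + M / N ≤ k → h ≤ 2 * M →
        truncNorm u τ ρ k ≤ ENNReal.ofReal C * ENNReal.ofReal N * truncNorm u σ R h),
      ∀ᵐ x ∂(volume.restrict (Metric.ball 0 (1 / 2))), u x ≤ C' * (U + F) := by
  have hσ1 : (1 : ℝ) ≤ σ := by exact_mod_cast hσ
  have hσ0 : (0 : ℝ) < σ := by linarith
  have hτ0 : (0 : ℝ) < τ := hσ0.trans (by exact_mod_cast hστ)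
  obtain ⟨θ, hθ⟩ : ∃ θ : ℝ, θ = 1 - σ / τ := ⟨_, rfl⟩
  have hθ0 : 0 < θ := by
    rw [hθ, sub_pos, div_lt_one hτ0]; exact_mod_cast hστ
  set κ : ℝ := (1 / 4 : ℝ) ^ (1 / θ) with hκ
  have hκ0 : 0 < κ := by positivity
  have hκ1 : κ < 1 := Real.rpow_lt_one (by norm_num) (by norm_num) (by positivity)
  have hκθ : κ ^ θ = 1 / 4 := by
    rw [hκ, ← Real.rpow_mul (by norm_num), one_div_mul_cancel hθ0.ne', Real.rpow_one]
  -- At gap `1/8` the smallness condition of the iteration holds with equality; `256 = 4 · 8²`.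
  set ε₀ : ℝ := (κ / (256 * C)) ^ (1 / θ) with hε₀
  have hε₀0 : 0 < ε₀ := by positivity
  have hε₀θ : ε₀ ^ θ = κ / (256 * C) := by
    rw [hε₀, ← Real.rpow_mul (by positivity), one_div_mul_cancel hθ0.ne', Real.rpow_one]
  set β : ℝ := κ ^ (σ : ℝ) with hβ
  have hβ0 : 0 < β := by positivity
  have hβ1 : β < 1 := Real.rpow_lt_one hκ0.le hκ1 hσ0
  -- At the `i`-th ball the coefficient of `U` has grown by `β^(-i)`. After `i` contractions by `t`
  -- it is weighted by `(t/β)^i = 2^(-i)`, which is summable.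
  set t : ℝ := β / 2 with ht
  have ht0 : 0 < t := by positivity
  have ht1 : t ≤ 1 / 2 := by rw [ht]; linarith
  set K : ℝ := (2 / ε₀ / t) ^ (σ : ℝ) with hK
  have hK0 : 0 < K := by positivity
  refine ⟨2 * K + 5, by positivity, fun u hu U F hU0 hF hU hfin hstep => ?_⟩
  have hεi : ∀ i : ℕ, C * (4 / ((1 / 8 : ℝ) * (1 / 2) ^ i) ^ 2) * (ε₀ * κ ^ i) ^ θ = κ := by
    intro i
    rw [Real.mul_rpow hε₀0.le (by positivity), hε₀θ, ← Real.rpow_natCast κ i,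
      ← Real.rpow_mul hκ0.le, mul_comm (i : ℝ) θ, Real.rpow_mul hκ0.le, hκθ, Real.rpow_natCast,
      show (1 / 4 : ℝ) ^ i = (1 / 2) ^ i * (1 / 2) ^ i by rw [← mul_pow]; norm_num]
    have : (0 : ℝ) < (1 / 2) ^ i := by positivity
    generalize ((1 : ℝ) / 2) ^ i = z at this
    field_simp
    norm_num
  have hlocal : ∀ (i : ℕ) (ρ R T : ℝ), 1 / 2 ≤ ρ → R - ρ = (1 / 8 : ℝ) * (1 / 2) ^ i → R ≤ 1 →
      0 ≤ T → truncNorm u σ R 0 ≤ ENNReal.ofReal T →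
      ∀ᵐ x ∂(volume.restrict (Metric.ball 0 ρ)), u x ≤ 2 * (F + T / (ε₀ * κ ^ i)) := by
    intro i ρ R T hρ hRρ hR hT hTn
    have hε : 0 < ε₀ * κ ^ i := by positivity
    have hTε : 0 ≤ T / (ε₀ * κ ^ i) := by positivity
    have hρR : ρ < R := by
      have : (0 : ℝ) < (1 / 8 : ℝ) * (1 / 2) ^ i := by positivity
      linarith
    -- The iteration is run with `M = F + T/ε`: large enough for `f`, and `T ≤ M ε`.
    refine ae_le_of_truncNorm_le hu hσ hστ hC (by linarith) (hstep _ (by linarith)) hρ hρR hR hθ hε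
      ?_ (hTn.trans (ENNReal.ofReal_le_ofReal ?_))
    · rw [hRρ]
      exact (hεi i).le
    · rw [add_mul, div_mul_cancel₀ _ hε.ne']
      have : 0 ≤ F * (ε₀ * κ ^ i) := by positivity
      linarith
  -- Radii grow from `1/2` towards `3/4`, with gaps `(1/8) 2^(-i)` matching the smallness condition
  -- above.
  set ρ : ℕ → ℝ := fun i => 3 / 4 - 1 / 4 * (1 / 2) ^ i with hρ
  have hρ_half : ∀ i, 1 / 2 ≤ ρ i := fun i => by
    have : ((1 : ℝ) / 2) ^ i ≤ 1 := pow_le_one₀ (by norm_num) (by norm_num)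
    simp only [hρ]; linarith
  have hρ_le : ∀ i, ρ i ≤ 3 / 4 := fun i => by
    have : (0 : ℝ) < (1 / 2) ^ i := by positivity
    simp only [hρ]; linarith
  have hreduce : ∀ (i : ℕ) (S : ℝ), 0 ≤ S →
      (∀ᵐ x ∂(volume.restrict (Metric.ball 0 (ρ (i + 1)))), u x ≤ S) →
      ∀ᵐ x ∂(volume.restrict (Metric.ball 0 (ρ i))), u x ≤ t * S + t * (K / β ^ i) * U + 2 * F := by
    intro i S hS huS
    have h1 := hlocal i (ρ i) (ρ (i + 1)) ((S ^ ((σ : ℝ) - 1) * U) ^ (1 / (σ : ℝ))) (hρ_half i)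
      (by simp only [hρ, pow_succ]; ring) ((hρ_le _).trans (by norm_num)) (by positivity)
      (truncNorm_le_interpolate hσ ((hρ_le _).trans (by norm_num)) hS hU0 hU huS)
    filter_upwards [h1] with x hx
    have h2 := mul_rpow_le_add hσ1 (by positivity : 0 < 2 / (ε₀ * κ ^ i)) ht0 hS hU0
    have h3 : (2 / (ε₀ * κ ^ i) / t) ^ (σ : ℝ) = K / β ^ i := by
      rw [show 2 / (ε₀ * κ ^ i) / t = (2 / ε₀ / t) / κ ^ i by field_simp,
        Real.div_rpow (by positivity) (by positivity), hK, hβ, ← Real.rpow_natCast κ i,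
        ← Real.rpow_natCast _ i, ← Real.rpow_mul hκ0.le, ← Real.rpow_mul hκ0.le, mul_comm (i : ℝ)]
    rw [h3] at h2
    refine hx.trans ?_
    calc 2 * (F + (S ^ ((σ : ℝ) - 1) * U) ^ (1 / (σ : ℝ)) / (ε₀ * κ ^ i))
        = 2 / (ε₀ * κ ^ i) * (S ^ ((σ : ℝ) - 1) * U) ^ (1 / (σ : ℝ)) + 2 * F := by ring
      _ ≤ _ := by linarith
  set G : ℝ := K * U + 2 * F with hG
  have hKU : 0 ≤ K * U := by positivity
  -- Each ball contributes at most `2^(-i) G`, so the sum stays below `2 G` for every `m`.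
  have hiter : ∀ (m : ℕ) (S : ℝ), 0 ≤ S →
      (∀ᵐ x ∂(volume.restrict (Metric.ball 0 (ρ m))), u x ≤ S) →
      ∀ᵐ x ∂(volume.restrict (Metric.ball 0 (1 / 2))),
        u x ≤ t ^ m * S + 2 * (1 - (1 / 2) ^ m) * G := by
    intro m
    induction m with
    | zero =>
      intro S _ huS
      have : ρ 0 = 1 / 2 := by simp only [hρ]; norm_num
      rw [this] at huS
      simpa using huS
    | succ m ih =>
      intro S hS huS
      have h1 := ih _ (by positivity) (hreduce m S hS huS)
      filter_upwards [h1] with x hx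
      refine hx.trans ?_
      have h2 : t ^ m * (t * S + t * (K / β ^ m) * U + 2 * F) =
          t ^ (m + 1) * S + t * ((1 / 2) ^ m * (K * U)) + t ^ m * (2 * F) := by
        have : t ^ m / β ^ m = (1 / 2) ^ m := by
          rw [← div_pow, ht]; congr 1; field_simp
        rw [← this]; field_simp; ring
      have h3 : t ^ m ≤ (1 / 2) ^ m := pow_le_pow_left₀ ht0.le ht1 m
      have h4 : t * ((1 / 2) ^ m * (K * U)) ≤ (1 / 2) ^ m * (K * U) :=
        mul_le_of_le_one_left (by positivity) (by linarith)
      have h5 : t ^ m * (2 * F) ≤ (1 / 2) ^ m * (2 * F) := by gcongr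
      rw [h2, pow_succ (1 / 2 : ℝ)]
      nlinarith
  obtain ⟨S₀, hS₀, huS₀⟩ : ∃ S₀ : ℝ, 0 ≤ S₀ ∧
      ∀ᵐ x ∂(volume.restrict (Metric.ball 0 (3 / 4))), u x ≤ S₀ := by
    refine ⟨_, ?_, hlocal 0 (3 / 4) (7 / 8) _ (by norm_num) (by norm_num) (by norm_num)
      ENNReal.toReal_nonneg (ENNReal.ofReal_toReal hfin).ge⟩
    positivity
  -- The a priori bound `S₀` is not quantitative. Enough contractions push it below `F`, which is
  -- why `F` must be strictly positive.
  obtain ⟨m, hm⟩ : ∃ m : ℕ, t ^ m * S₀ < F := by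
    have := (tendsto_pow_atTop_nhds_zero_of_lt_one ht0.le (by linarith)).mul_const S₀
    rw [zero_mul] at this
    exact (this.eventually (gt_mem_nhds hF)).exists
  have hfinal := hiter m S₀ hS₀ (ae_restrict_of_ae_restrict_of_subset
    (Metric.ball_subset_ball (hρ_le m)) huS₀)
  filter_upwards [hfinal] with x hx
  have h1 : 2 * (1 - (1 / 2 : ℝ) ^ m) * G ≤ 2 * G := by
    have : (0 : ℝ) < (1 / 2) ^ m := by positivity
    have hG0 : 0 ≤ G := by positivity
    nlinarith
  have h2 : 0 ≤ K * F := by positivity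
  rw [hG] at h1
  nlinarith

end LocalMaximum

/-! ### The local maximum principle -/

section Main

open Filter Topology

/-- A Sobolev function is in `L^σ` on smaller balls, with `1 / σ = 1 / r - 1 / n`. -/
theorem HasSobolevGradient.truncNorm_ne_top {n : ℕ} (hn : 0 < n) {p : ℝ≥0∞} (hp : p ≠ ⊤)
    {u : EuclideanSpace ℝ (Fin n) → ℝ} {Du : EuclideanSpace ℝ (Fin n) → EuclideanSpace ℝ (Fin n)}
    (hu : HasSobolevGradient (Metric.ball 0 1) p u Du) {σ r : NNReal} (hr1 : 1 ≤ r)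
    (hrp : (r : ℝ≥0∞) ≤ p) (hσ : (σ : ℝ)⁻¹ = (r : ℝ)⁻¹ - (n : ℝ)⁻¹) :
    truncNorm u σ (7 / 8) 0 ≠ ⊤ := by
  obtain ⟨c, -, hcut⟩ := exists_cutoff n
  obtain ⟨η, hη, -, hη1, -, -⟩ := hcut 8 (7 / 8) 1 (by norm_num) (by norm_num) (by norm_num) le_rfl
  have hp1 : 1 ≤ p := le_trans (by exact_mod_cast hr1) hrp
  have hfin : IsFiniteMeasure
      (volume.restrict (Metric.ball (0 : EuclideanSpace ℝ (Fin n)) 1)) := ⟨by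
    rw [Measure.restrict_apply_univ]; exact measure_ball_lt_top⟩
  have hW := hu.mul_comp Metric.isOpen_ball hp1 hp hη (G := id) contDiff_id rfl (B := 1)
    fun t => by simp
  have hgns := hW.eLpNorm_le hn hp hr1 hrp hσ
  have hle : truncNorm u σ (7 / 8) 0 ≤
      eLpNorm (fun x => η x * id (u x)) σ (volume.restrict (Metric.ball 0 1)) := by
    refine (eLpNorm_mono_ae ?_).trans (eLpNorm_mono_measure _
      (Measure.restrict_mono (Metric.ball_subset_ball (by norm_num : (7 / 8 : ℝ) ≤ 1)) le_rfl))
    filter_upwards [ae_restrict_mem measurableSet_ball] with x hx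
    rw [hη1 x hx, one_mul, sub_zero, Real.norm_of_nonneg (le_max_right _ _), id]
    exact max_le (le_abs_self _) (abs_nonneg _)
  refine ne_top_of_le_ne_top ?_ (hle.trans hgns)
  exact ENNReal.mul_ne_top ENNReal.coe_ne_top (hW.memLp_grad.mono_exponent hrp).2.ne

theorem eLpNorm_le_ofReal_of_lpNorm_le {α F : Type*} [MeasurableSpace α] [NormedAddCommGroup F]
    {μ : Measure α} {f : α → F} {p : ℝ≥0∞} {b : ℝ} (hf : MemLp f p μ) (h : lpNorm f p μ ≤ b) :
    eLpNorm f p μ ≤ ENNReal.ofReal b := by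
  rw [← ofReal_lpNorm hf]
  exact ENNReal.ofReal_le_ofReal h

theorem lemma4p1 (n : ℕ) (hn : 2 ≤ n) (p q : ℝ≥0∞) (hp : p ≠ ⊤)
    (hpq : (n : ℝ≥0∞) / p + 1 / q < 2 / (n : ℝ≥0∞)) (Λ δ K : ℝ) :
    ∃ C : ℝ, 0 < C ∧
      ∀ (p₀ : ℝ≥0∞) (_ : p / ((n : ℝ≥0∞) - 1) ≤ p₀)
        (a : EuclideanSpace ℝ (Fin n) → Matrix (Fin n) (Fin n) ℝ)
        (lam d c f u : EuclideanSpace ℝ (Fin n) → ℝ)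
        (_ : DegenerateElliptic (Metric.ball 0 1) a lam d)
        (_ : MemLp lam p (volume.restrict (Metric.ball 0 1)))
        (_ : lpNorm lam p (volume.restrict (Metric.ball 0 1)) ≤ Λ)
        (_ : MemLp (fun x => (d x)⁻¹) q (volume.restrict (Metric.ball 0 1)))
        (_ : lpNorm (fun x => (d x)⁻¹) q (volume.restrict (Metric.ball 0 1)) ≤ δ)
        (_ : MemLp c p₀ (volume.restrict (Metric.ball 0 1)))
        (_ : lpNorm c p₀ (volume.restrict (Metric.ball 0 1)) ≤ K)
        (_ : MemLp f p₀ (volume.restrict (Metric.ball 0 1)))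
        (_ : IsWeakSubsolution (Metric.ball 0 1) p a c f u),
        essSup (fun x => (u x : EReal)) (volume.restrict (Metric.ball 0 (1 / 2))) ≤
          ((C * (lpNorm (fun x => max (u x) 0) 1 (volume.restrict (Metric.ball 0 1)) +
            lpNorm f p₀ (volume.restrict (Metric.ball 0 1))) : ℝ) : EReal) := by
  obtain ⟨hp1, hs1, -, σ, τ, r, r', hσ1, hστ, hr1, hrp, hr1', hrp', hτ, hσr, hσs, hr⟩ :=
    exists_exponents hn hp hpq
  obtain ⟨C₁, hC₁, hstep⟩ := exists_step_constant hn (q := q) hp hp1 hs1 hr1 hrp hτ hσs hr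
    (ENNReal.ofReal_ne_top (r := Λ)) (ENNReal.ofReal_ne_top (r := δ))
    (ENNReal.ofReal_ne_top (r := K))
  obtain ⟨C, hC, hmax⟩ := exists_ae_le_of_step (n := n) hσ1 hστ
    (C := C₁.toReal + 1) (by positivity)
  refine ⟨C, hC, fun p₀ hp₀ a lam d c f u ha hlam hlamΛ hd hdδ hc hcK hf hu => ?_⟩
  obtain ⟨Du, hDu, -⟩ := id hu
  have hfin : IsFiniteMeasure
      (volume.restrict (Metric.ball (0 : EuclideanSpace ℝ (Fin n)) 1)) := ⟨by
    rw [Measure.restrict_apply_univ]; exact measure_ball_lt_top⟩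
  set U := lpNorm (fun x => max (u x) 0) 1 (volume.restrict (Metric.ball 0 1)) with hU
  set F := lpNorm f p₀ (volume.restrict (Metric.ball 0 1)) with hF
  have hup : MemLp (fun x => max (u x) 0) 1 (volume.restrict (Metric.ball 0 1)) :=
    (hDu.memLp.mono_exponent hp1).pos_part
  -- The norm of `f` may vanish, so a positive `ε` is added and removed at the end along `1/(m+1)`,
  -- a countable family of null sets.
  have hbound : ∀ ε : ℝ, 0 < ε → ∀ᵐ x ∂(volume.restrict (Metric.ball 0 (1 / 2))),
      u x ≤ C * (U + (F + ε)) := by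
    intro ε hε
    have hF0 : 0 ≤ F := lpNorm_nonneg
    refine hmax u hDu.memLp.1 U (F + ε) lpNorm_nonneg (by linarith) ?_
      (hDu.truncNorm_ne_top (by omega) hp hr1' hrp' hσr) fun M hM N ρ R h k hN hρ hρR hR h0 hk hhM => ?_
    · simp only [truncNorm, sub_zero]
      exact eLpNorm_le_ofReal_of_lpNorm_le hup le_rfl
    · refine (hstep p₀ hp₀ a lam d c f u ha hlam.1 (eLpNorm_le_ofReal_of_lpNorm_le hlam hlamΛ) hd.1
        (eLpNorm_le_ofReal_of_lpNorm_le hd hdδ) hc.1 (eLpNorm_le_ofReal_of_lpNorm_le hc hcK) hf.1 hu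
        M (by linarith) (eLpNorm_le_ofReal_of_lpNorm_le hf (by linarith)) N ρ R h k hN hρ hρR hR h0
        hk hhM).trans ?_
      refine mul_le_mul' (mul_le_mul' ?_ le_rfl) le_rfl
      rw [← ENNReal.ofReal_toReal hC₁]
      exact ENNReal.ofReal_le_ofReal (by rw [ENNReal.ofReal_toReal hC₁]; linarith)
  have hall : ∀ᵐ x ∂(volume.restrict (Metric.ball 0 (1 / 2))), ∀ m : ℕ,
      u x ≤ C * (U + (F + 1 / ((m : ℝ) + 1))) :=
    ae_all_iff.2 fun m => hbound _ (by positivity)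
  refine essSup_le_of_ae_le _ ?_
  filter_upwards [hall] with x hx
  have h1 := (tendsto_one_div_add_atTop_nhds_zero_nat (𝕜 := ℝ)).const_add F
  rw [add_zero] at h1
  exact EReal.coe_le_coe_iff.2 (ge_of_tendsto' ((h1.const_add U).const_mul C) hx)

end Main
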